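/- For $p>0$, $p\ne1$, let $\mathcal V(p)=R(p)+S(p)$, where $$R(p)=\begin{cases}\dfrac{2\log p}{1+p^2}-\dfrac{2}{p\sqrt{1+p^2}}\,\mathrm{artanh}\dfrac{p}{\sqrt{1+p^2}},&p<1,\\[2mm]-\dfrac{2\log p}{p(1+p^2)}-\dfrac{2}{p\sqrt{1+p^2}}\,\mathrm{artanh}\dfrac{1}{\sqrt{1+p^2}},&p>1,\end{cases}$$ $$S(p)=\begin{cases}-\dfrac{2\log p}{1-p^2}+\dfrac{2}{p\sqrt{1-p^2}}\arctan\dfrac{p}{\sqrt{1-p^2}},&p<1,\\[2mm]\dfrac{2\log p}{p(p^2-1)}+\dfrac{2}{p\sqrt{p^2-1}}\arctan\dfrac{1}{\sqrt{p^2-1}},&p>1.\end{cases}$$ Put $K(x)=\mathcal V(e^{x/2})$ for $x\in\mathbb R$, and $\gamma=-2\left(2G+\tfrac{7\pi^2}{24}\right)$ with $G=\sum_{n\ge0}(-1)^n(2n+1)^{-2}$ Catalan's constant. For a function $g$ on $\mathbb R$ write $\widehat g(\xi)=\int_{\mathbb R}e^{-ix\xi}g(x)\,dx$ for complex $\xi$.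 Let $X_{A,B}$ be the space of real $f\in L^\infty_{\rm loc}(\mathbb R)$ with $\sup_{x<0}e^{-Ax}|f(x)|+\sup_{x>0}e^{-Bx}|f(x)|<\infty$ (essential suprema). Then $K(x)e^{3x/4}$ is integrable and $\gamma+\widehat K(3i/4)$ is a negative real number, written $-\nu$. For every $L\in\mathbb R$ there is a constant $C=C(L)>0$ with the following property. Let $$-\tfrac52<B<-\tfrac34<\tfrac12<A<1,\qquad f_0\in X_{A,B},\qquad 1\le p<\infty.$$ The problem $\partial_tf(t,x)=\gamma f(t,x)+\int_{\mathbb R}K(x-y)f(t,y)\,dy$ $(t>0)$, $f(0)=f_0$, has a solution $f\in C([0,\infty);L^p(\mathbb R))\cap C^1((0,\infty);L^p(\mathbb R))$, and for every such solution, every $t>0$ and every $\sigma$ with $\tfrac12<\sigma<-B$ (in particular every $\sigma>\tfrac12$ close to $\tfrac12$), $$\int_{-\infty}^Lf(t,x)e^{x/2}\,dx=\int_{\mathbb R}f(t,x)e^{x/2}\,dx+\frac1{2\pi}\int_{\operatorname{Im}\xi=\sigma}\widehat f_0(\xi)\,e^{(\gamma+\widehat K(\xi))t}\,\frac{e^{L(i\xi+\frac12)}}{i\xi+\frac12}\,d\xi,$$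 where all the integrals (including those defining $\widehat f_0$ and $\widehat K$ on the line $\operatorname{Im}\xi=\sigma$) are absolutely convergent and the total wave action $\int_{\mathbb R}f(t,x)e^{x/2}\,dx$ equals $\int_{\mathbb R}f_0(x)e^{x/2}\,dx$. Moreover $\int_{\mathbb R}|f_0(x)|e^{3x/4}\,dx<\infty$ and $$\left|\int_{\operatorname{Im}\xi=\sigma}\widehat f_0(\xi)\,e^{(\gamma+\widehat K(\xi))t}\,\frac{e^{L(i\xi+\frac12)}}{i\xi+\frac12}\,d\xi\right|\le C\,e^{-\nu t}\int_{\mathbb R}|f_0(x)|e^{3x/4}\,dx .$$ -/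

import Mathlib

open MeasureTheory Set
open scoped ENNReal

namespace RJ

noncomputable section

/-- The part `R` of the kernel of the linearised operator, in the variable `p > 0`. -/
def kernelR (p : ℝ) : ℝ :=
  if p < 1 then
    2 * Real.log p / (1 + p ^ 2)
      - 2 / (p * √(1 + p ^ 2)) * Real.artanh (p / √(1 + p ^ 2))
  else if 1 < p then
    -(2 * Real.log p / (p * (1 + p ^ 2))
      + 2 / (p * √(1 + p ^ 2)) * Real.artanh (1 / √(1 + p ^ 2)))
  else 0

/-- The part `S` of the kernel. The inverse function is the circular `arctan`: this is what gives
the kernel `𝒱 = R + S` its behaviour `-4 p² (log p - 2/3)` at `0` and `π / √(2 |p - 1|)` at `1`. -/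
def kernelS (p : ℝ) : ℝ :=
  if p < 1 then
    -(2 * Real.log p / (1 - p ^ 2))
      + 2 / (p * √(1 - p ^ 2)) * Real.arctan (p / √(1 - p ^ 2))
  else if 1 < p then
    2 * Real.log p / (p * (p ^ 2 - 1))
      + 2 / (p * √(p ^ 2 - 1)) * Real.arctan (1 / √(p ^ 2 - 1))
  else 0

/-- The kernel `𝒱` of the equation linearised around `p⁻²`. -/
def kernelV (p : ℝ) : ℝ := kernelR p + kernelS p

/-- The kernel in the variable `x = 2 log p`. -/
def K (x : ℝ) : ℝ := kernelV (Real.exp (x / 2))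

/-- Catalan's constant. -/
def catalanG : ℝ := ∑' n : ℕ, (-1 : ℝ) ^ n / (2 * (n : ℝ) + 1) ^ 2

/-- The explicit negative constant `γ_N = -(2 G + 7 π² / 24) ≈ -4.7106`. It is the closed form of
`-∬ min {1, p₂, p₃, p₄} (p₂ p₃ p₄)⁻² p₃ p₄ dp₃ dp₄` over `p₃, p₄ > 0`, `p₂² = p₃² + p₄² - 1 > 0`,
the coefficient of the unintegrated perturbation in the linearised collision operator. -/
def gammaN : ℝ := -(2 * catalanG + 7 * Real.pi ^ 2 / 24)

/-- `γ = 2 γ_N`. -/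
def gamma : ℝ := 2 * gammaN

/-- The Fourier transform `ĝ(ξ) = ∫ e^{-ixξ} g(x) dx` at complex `ξ`. -/
def hat (g : ℝ → ℝ) (ξ : ℂ) : ℂ :=
  ∫ x : ℝ, Complex.exp (-(Complex.I * (x : ℂ) * ξ)) * (g x : ℂ)

/-- `Ω(ξ) = γ + K̂(ξ)`. -/
def Omega (ξ : ℂ) : ℂ := (gamma : ℂ) + hat K ξ

/-- `‖g‖_{X_{A,B}} = sup_{x<0} e^{-Ax}|g(x)| + sup_{x>0} e^{-Bx}|g(x)|`, with essential suprema. -/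
def normX (A B : ℝ) (g : ℝ → ℝ) : ℝ≥0∞ :=
  eLpNorm (fun x => Real.exp (-A * x) * g x) ∞ (volume.restrict (Iio 0))
    + eLpNorm (fun x => Real.exp (-B * x) * g x) ∞ (volume.restrict (Ioi 0))

/-- `g ∈ X_{A,B}`: `g` is in `L^∞_loc(ℝ)` and has finite norm. -/
def MemX (A B : ℝ) (g : ℝ → ℝ) : Prop :=
  (∀ S : Set ℝ, IsCompact S → MemLp g ∞ (volume.restrict S)) ∧ normX A B g < ∞

/-- `f ∈ C([0,∞); L^p(ℝ)) ∩ C¹((0,∞); L^p(ℝ))` solves `∂f/∂t = γ f + K ∗ f` in `L^p(ℝ)` for all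
`t > 0`, with initial datum `f₀`. -/
structure IsSolution (p : ℝ≥0∞) [Fact (1 ≤ p)] (f₀ : ℝ → ℝ)
    (f : ℝ → Lp ℝ p (volume : Measure ℝ)) : Prop where
  continuousOn : ContinuousOn f (Ici 0)
  contDiffOn : ContDiffOn ℝ 1 f (Ioi 0)
  initial : f 0 =ᵐ[volume] f₀
  equation : ∀ t : ℝ, 0 < t →
    (deriv f t : Lp ℝ p (volume : Measure ℝ)) =ᵐ[volume] fun x => gamma * f t x + ∫ y : ℝ, K (x - y) * f t y

/-- The integrand `f̂₀(ξ) e^{(γ + K̂(ξ)) t} e^{L (iξ + 1/2)} / (iξ + 1/2)`. -/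
def contourIntegrand (f₀ : ℝ → ℝ) (t L : ℝ) (ξ : ℂ) : ℂ :=
  hat f₀ ξ * Complex.exp (Omega ξ * (t : ℂ))
    * (Complex.exp ((L : ℂ) * (Complex.I * ξ + 1 / 2)) / (Complex.I * ξ + 1 / 2))

end

end RJ

namespace RJ

/-!
Multiplication by `e^{σx}` commutes with the equation up to replacing `K` by `K e^{σx}`, which is
integrable for `-1 < σ < 5/2`. Young's inequality makes the generator bounded on the weighted
spaces, so solutions are given by its exponential there: on the line `Im ξ = σ` the Fourier
transform of a solution evolves by `e^{Ω(ξ) t}`, and the `L¹` norm with weight `e^{sx}` grows at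
most like `e^{Ω(is) t}`, because `K ≥ 0`. Since `e^{L(iξ + 1/2)} / (iξ + 1/2)` is, up to sign and
conjugation, the Fourier transform of `e^{(1/2 - σ)x}` on `(L, ∞)`, Parseval's identity turns the
contour integral into the tail `∫_L^∞ f e^{x/2}`, which the weighted `L¹` norm controls.

The closed form of `γ` gives `Ω(i/2) = 0`, which is the conservation of the wave action, and the
symmetry `p ↦ 1/p` of `𝒱` gives `Ω(i) = Ω(i/2)`. As `s ↦ Ω(is)` is strictly convex, it is negative
in between.
-/

/-! ### Parseval's identity -/

section Parseval

open FourierTransform SchwartzMap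

variable {V E : Type*} [NormedAddCommGroup V] [InnerProductSpace ℝ V] [FiniteDimensional ℝ V]
  [MeasurableSpace V] [BorelSpace V] [NormedAddCommGroup E] [InnerProductSpace ℂ E]
  [CompleteSpace E] {g h : V → E}

theorem integral_fourier_smul_eq_integral_smul_fourier {φ : V → ℂ} (hφ : Integrable φ)
    (hg : Integrable g) : ∫ w, 𝓕 φ w • g w = ∫ x, φ x • 𝓕 g x := by
  have := VectorFourier.integral_fourierIntegral_smul_eq_flip (L := innerₗ V)
    (μ := (volume : Measure V)) (ν := (volume : Measure V))
    Real.continuous_fourierChar continuous_inner hφ hg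
  rwa [flip_innerₗ] at this

theorem integral_smul_fourier_toLp (ψ : 𝓢(V, ℂ)) (hg : MemLp g 2) :
    ∫ x, ψ x • (𝓕 (hg.toLp g) : Lp E 2 (volume : Measure V)) x = ∫ w, 𝓕 (ψ : V → ℂ) w • g w := by
  have h := congrArg (fun T : 𝓢'(V, E) => T ψ)
    (Lp.fourier_toTemperedDistribution_eq (hg.toLp g))
  simp only [TemperedDistribution.fourier_apply, Lp.toTemperedDistribution_apply] at h
  rw [← h, SchwartzMap.fourier_coe]
  refine integral_congr_ae ?_
  filter_upwards [hg.coeFn_toLp] with x hx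
  rw [hx]

theorem fourier_toLp_ae_eq (hg₁ : Integrable g) (hg₂ : MemLp g 2) :
    (𝓕 (hg₂.toLp g) : Lp E 2 (volume : Measure V)) =ᵐ[volume] 𝓕 g := by
  have hcont : Continuous (𝓕 g) :=
    VectorFourier.fourierIntegral_continuous Real.continuous_fourierChar
      (L := innerₗ V) continuous_inner hg₁
  refine ae_eq_of_integral_contDiff_smul_eq
    ((Lp.memLp (𝓕 (hg₂.toLp g))).locallyIntegrable (by norm_num))
    hcont.locallyIntegrable fun φ hφ hc => ?_
  let ψ : 𝓢(V, ℂ) := (hc.comp_left (g := ((↑) : ℝ → ℂ)) Complex.ofReal_zero).toSchwartzMap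
    (Complex.ofRealCLM.contDiff.comp hφ)
  have hψ (v : E) (x : V) : φ x • v = ψ x • v := (Complex.coe_smul (φ x) v).symm
  simp only [hψ]
  rw [integral_smul_fourier_toLp,
    integral_fourier_smul_eq_integral_smul_fourier ψ.integrable hg₁]

theorem integral_inner_fourier_fourier (hh₁ : Integrable h) (hh₂ : MemLp h 2)
    (hg₁ : Integrable g) (hg₂ : MemLp g 2) :
    ∫ w, inner ℂ (𝓕 h w) (𝓕 g w) = ∫ x, inner ℂ (h x) (g x) := by
  have e := Lp.inner_fourier_eq (hh₂.toLp h) (hg₂.toLp g)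
  rw [L2.inner_def, L2.inner_def] at e
  refine Eq.trans (integral_congr_ae ?_) (e.trans (integral_congr_ae ?_))
  · filter_upwards [fourier_toLp_ae_eq hg₁ hg₂, fourier_toLp_ae_eq hh₁ hh₂] with x hgx hhx
    rw [hgx, hhx]
  · filter_upwards [hg₂.coeFn_toLp, hh₂.coeFn_toLp] with x hgx hhx
    rw [hgx, hhx]

theorem integrable_inner_fourier_fourier (hh₁ : Integrable h) (hh₂ : MemLp h 2)
    (hg₁ : Integrable g) (hg₂ : MemLp g 2) :
    Integrable fun w => inner ℂ (𝓕 h w) (𝓕 g w) := by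
  refine (L2.integrable_inner (𝕜 := ℂ) (𝓕 (hh₂.toLp h)) (𝓕 (hg₂.toLp g))).congr ?_
  filter_upwards [fourier_toLp_ae_eq hg₁ hg₂, fourier_toLp_ae_eq hh₁ hh₂] with x hgx hhx
  rw [hgx, hhx]

end Parseval

/-! ### The contour integral of a transform -/

section Contour

open FourierTransform

theorem hat_line_eq_fourier (f : ℝ → ℝ) (σ u : ℝ) :
    hat f (u + σ * Complex.I)
      = 𝓕 (fun x : ℝ => ((f x * Real.exp (σ * x) : ℝ) : ℂ)) (u / (2 * Real.pi)) := by
  rw [Real.fourier_real_eq_integral_exp_smul, hat]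
  refine integral_congr_ae (Filter.Eventually.of_forall fun x => ?_)
  have hpi : (Real.pi : ℂ) ≠ 0 := by exact_mod_cast Real.pi_ne_zero
  simp only [smul_eq_mul]
  push_cast
  rw [mul_comm ((f x : ℂ)), ← mul_assoc, ← Complex.exp_add]
  congr 2
  field_simp
  linear_combination (-(x : ℂ) * σ) * Complex.I_sq

/-- The exponential `e^{cx}` cut off to the half-line `x > L`. -/
noncomputable def truncExp (c L : ℝ) : ℝ → ℝ :=
  (Ioi L).indicator fun x => Real.exp (c * x)

/-- The weight `e^{L(iξ + a)} / (iξ + a)` of the contour integral; up to sign it is the conjugate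
of the Fourier transform of `truncExp (a - σ) L` on the line `Im ξ = σ`. -/
noncomputable def contourWeight (a L : ℝ) (ξ : ℂ) : ℂ :=
  Complex.exp (L * (Complex.I * ξ + a)) / (Complex.I * ξ + a)

theorem integrable_truncExp {c : ℝ} (hc : c < 0) (L : ℝ) : Integrable (truncExp c L) :=
  (integrable_indicator_iff measurableSet_Ioi).2 (integrableOn_exp_mul_Ioi hc L)

theorem truncExp_mul_exp (c d L x : ℝ) :
    truncExp c L x * Real.exp (d * x) = truncExp (c + d) L x := by
  by_cases hx : x ∈ Ioi L
  · simp only [truncExp, indicator_of_mem hx, ← Real.exp_add, add_mul]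
  · simp only [truncExp, indicator_of_notMem hx, zero_mul]

theorem truncExp_sq (c L x : ℝ) : truncExp c L x ^ 2 = truncExp (c + c) L x := by
  rw [sq, ← truncExp_mul_exp]
  by_cases hx : x ∈ Ioi L
  · simp only [truncExp, indicator_of_mem hx]
  · simp only [truncExp, indicator_of_notMem hx, zero_mul]

theorem memLp_two_truncExp {c : ℝ} (hc : c < 0) (L : ℝ) : MemLp (truncExp c L) 2 := by
  rw [memLp_two_iff_integrable_sq (integrable_truncExp hc L).aestronglyMeasurable]
  simpa only [truncExp_sq] using integrable_truncExp (add_neg hc hc) L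

theorem fourier_truncExp {c : ℝ} (hc : c < 0) (L u : ℝ) :
    𝓕 (fun x => (truncExp c L x : ℂ)) (u / (2 * Real.pi))
      = -(Complex.exp ((c - u * Complex.I) * L) / (c - u * Complex.I)) := by
  have hpi : (Real.pi : ℂ) ≠ 0 := by exact_mod_cast Real.pi_ne_zero
  rw [Real.fourier_real_eq_integral_exp_smul, ← neg_div,
    ← integral_exp_mul_complex_Ioi (a := c - u * Complex.I) (by simpa using hc) L,
    ← integral_indicator measurableSet_Ioi]
  refine integral_congr_ae (Filter.Eventually.of_forall fun x => ?_)
  by_cases hx : x ∈ Ioi L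
  · simp only [truncExp, indicator_of_mem hx, smul_eq_mul]
    push_cast
    rw [← Complex.exp_add]
    congr 1
    field_simp
    ring
  · simp [truncExp, indicator_of_notMem hx]

theorem conj_fourier_truncExp {a σ : ℝ} (hσ : a < σ) (L u : ℝ) :
    starRingEnd ℂ (𝓕 (fun x => (truncExp (a - σ) L x : ℂ)) (u / (2 * Real.pi)))
      = -contourWeight a L (u + σ * Complex.I) := by
  have hconj : starRingEnd ℂ (((a - σ : ℝ) : ℂ) - u * Complex.I)
      = Complex.I * (u + σ * Complex.I) + a := by
    simp only [map_sub, map_mul, Complex.conj_ofReal, Complex.conj_I]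
    push_cast
    linear_combination -(σ : ℂ) * Complex.I_sq
  rw [fourier_truncExp (sub_neg.2 hσ), map_neg, map_div₀, ← Complex.exp_conj, map_mul, hconj,
    Complex.conj_ofReal, mul_comm _ (L : ℂ), contourWeight]

variable {F : ℝ → ℝ} {a σ : ℝ}

theorem hat_mul_contourWeight_eq (hσ : a < σ) (L u : ℝ) :
    hat F (u + σ * Complex.I) * contourWeight a L (u + σ * Complex.I)
      = -inner ℂ (𝓕 (fun x => (truncExp (a - σ) L x : ℂ)) (u / (2 * Real.pi)))
          (𝓕 (fun x => ((F x * Real.exp (σ * x) : ℝ) : ℂ)) (u / (2 * Real.pi))) := by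
  rw [RCLike.inner_apply, conj_fourier_truncExp hσ, hat_line_eq_fourier, mul_neg, neg_neg]

theorem integrable_hat_mul_contourWeight (hσ : a < σ) (L : ℝ)
    (h₁ : Integrable fun x => F x * Real.exp (σ * x))
    (h₂ : MemLp (fun x => F x * Real.exp (σ * x)) 2) :
    Integrable fun u : ℝ =>
      hat F (u + σ * Complex.I) * contourWeight a L (u + σ * Complex.I) := by
  simp only [hat_mul_contourWeight_eq hσ]
  have hc := sub_neg.2 hσ
  exact ((integrable_inner_fourier_fourier (integrable_truncExp hc L).ofReal
    (memLp_two_truncExp hc L).ofReal h₁.ofReal h₂.ofReal).comp_div Real.two_pi_pos.ne').neg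

theorem integral_hat_mul_contourWeight (hσ : a < σ) (L : ℝ)
    (h₁ : Integrable fun x => F x * Real.exp (σ * x))
    (h₂ : MemLp (fun x => F x * Real.exp (σ * x)) 2) :
    ∫ u : ℝ, hat F (u + σ * Complex.I) * contourWeight a L (u + σ * Complex.I)
      = -(2 * Real.pi * ((∫ x in Ioi L, F x * Real.exp (a * x) : ℝ) : ℂ)) := by
  have hc := sub_neg.2 hσ
  simp only [hat_mul_contourWeight_eq hσ, integral_neg]
  rw [Measure.integral_comp_div (fun w : ℝ => inner ℂ
      (𝓕 (fun x => (truncExp (a - σ) L x : ℂ)) w)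
      (𝓕 (fun x => ((F x * Real.exp (σ * x) : ℝ) : ℂ)) w)),
    integral_inner_fourier_fourier (integrable_truncExp hc L).ofReal
      (memLp_two_truncExp hc L).ofReal h₁.ofReal h₂.ofReal,
    abs_of_pos Real.two_pi_pos, Complex.real_smul, Complex.ofReal_mul, Complex.ofReal_ofNat,
    ← integral_complex_ofReal, ← integral_indicator measurableSet_Ioi]
  congr 3 with x
  by_cases hx : x ∈ Ioi L
  · simp only [truncExp, indicator_of_mem hx, RCLike.inner_apply, Complex.conj_ofReal,
      ← Complex.ofReal_mul]
    rw [mul_assoc, ← Real.exp_add, ← add_mul, add_sub_cancel]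
  · simp [truncExp, indicator_of_notMem hx]

end Contour

/-! ### Convolution with an integrable function as an operator on `L^p` -/

section Young

open scoped Convolution

variable {G : Type*} [MeasurableSpace G] {μ : Measure G} {p : ℝ≥0∞}

theorem lintegral_mul_rpow_le {a b : G → ℝ≥0∞} (ha : AEMeasurable a μ) (hb : AEMeasurable b μ)
    {r : ℝ} (hr : 1 ≤ r) :
    (∫⁻ t, a t * b t ∂μ) ^ r ≤ (∫⁻ t, a t ∂μ) ^ (r - 1) * ∫⁻ t, a t * b t ^ r ∂μ := by
  have hr₀ : 0 < r := by linarith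
  have hinv : 0 ≤ 1 - r⁻¹ := sub_nonneg.2 (inv_le_one_of_one_le₀ hr)
  have hsplit (t : G) : a t ^ (1 - r⁻¹) * (a t * b t ^ r) ^ r⁻¹ = a t * b t := by
    rw [ENNReal.mul_rpow_of_nonneg _ _ (by positivity), ← mul_assoc,
      ← ENNReal.rpow_add_of_nonneg _ _ hinv (by positivity), sub_add_cancel, ENNReal.rpow_one,
      ENNReal.rpow_rpow_inv hr₀.ne']
  have hHolder := ENNReal.lintegral_mul_norm_pow_le (g := fun t => a t * b t ^ r) ha (by fun_prop)
    hinv (inv_nonneg.2 hr₀.le) (sub_add_cancel 1 r⁻¹)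
  simp only [hsplit] at hHolder
  calc (∫⁻ t, a t * b t ∂μ) ^ r
      ≤ ((∫⁻ t, a t ∂μ) ^ (1 - r⁻¹) * (∫⁻ t, a t * b t ^ r ∂μ) ^ r⁻¹) ^ r := by gcongr
    _ = _ := by
        rw [ENNReal.mul_rpow_of_nonneg _ _ hr₀.le, ENNReal.rpow_inv_rpow hr₀.ne',
          ← ENNReal.rpow_mul, sub_mul, one_mul, inv_mul_cancel₀ hr₀.ne']

theorem ae_lt_top_of_eLpNorm_lt_top {h : G → ℝ≥0∞} (hh : AEMeasurable h μ) (hp : p ≠ 0)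
    (hfin : eLpNorm h p μ < ∞) : ∀ᵐ x ∂μ, h x < ∞ := by
  rcases eq_or_ne p ∞ with rfl | hp'
  · rw [eLpNorm_exponent_top] at hfin
    filter_upwards [enorm_ae_le_eLpNormEssSup h μ] with x hx using hx.trans_lt hfin
  · filter_upwards [ae_lt_top' (by fun_prop)
      (lintegral_rpow_enorm_lt_top_of_eLpNorm_lt_top hp hp' hfin).ne] with x hx
    exact (ENNReal.rpow_lt_top_iff_of_pos (ENNReal.toReal_pos hp hp')).1 hx

variable [AddGroup G]

variable {𝕜 E E' F : Type*} [NontriviallyNormedField 𝕜] [NormedAddCommGroup E] [NormedSpace 𝕜 E]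
  [NormedAddCommGroup E'] [NormedSpace 𝕜 E'] [NormedAddCommGroup F] [NormedSpace 𝕜 F]
  (L : E →L[𝕜] E' →L[𝕜] F) {f : G → E} {g : G → E'}

theorem lintegral_enorm_convolution_integrand_le (x : G) :
    ∫⁻ t, ‖L (f t) (g (x - t))‖ₑ ∂μ ≤ ‖L‖ₑ * ∫⁻ t, ‖f t‖ₑ * ‖g (x - t)‖ₑ ∂μ := by
  rw [← lintegral_const_mul' _ _ enorm_ne_top]
  exact lintegral_mono fun t => (L.le_opENorm₂ _ _).trans_eq (mul_assoc _ _ _)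

variable [MeasurableAdd₂ G] [MeasurableNeg G] [SFinite μ] [μ.IsAddRightInvariant]

theorem aemeasurable_mul_comp_sub {a b : G → ℝ≥0∞} (ha : AEMeasurable a μ)
    (hb : AEMeasurable b μ) :
    AEMeasurable (fun z : G × G => a z.2 * b (z.1 - z.2)) (μ.prod μ) :=
  ha.comp_snd.mul
    (hb.comp_quasiMeasurePreserving (quasiMeasurePreserving_sub_of_right_invariant μ μ))

theorem lintegral_lintegral_mul_sub {a b : G → ℝ≥0∞} (ha : AEMeasurable a μ)
    (hb : AEMeasurable b μ) :
    ∫⁻ x, ∫⁻ t, a t * b (x - t) ∂μ ∂μ = (∫⁻ t, a t ∂μ) * ∫⁻ t, b t ∂μ := by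
  rw [lintegral_lintegral_swap (aemeasurable_mul_comp_sub ha hb)]
  have hinner (t : G) : ∫⁻ x, a t * b (x - t) ∂μ = a t * ∫⁻ x, b x ∂μ := by
    have hbt : AEMeasurable (fun x => b (x - t)) μ :=
      hb.comp_quasiMeasurePreserving (measurePreserving_sub_right μ t).quasiMeasurePreserving
    rw [lintegral_const_mul'' _ hbt, lintegral_sub_right_eq_self b t]
  simp_rw [hinner]
  exact lintegral_mul_const'' _ ha

theorem lintegral_rpow_lintegral_mul_sub_le {a b : G → ℝ≥0∞} (ha : AEMeasurable a μ)
    (hb : AEMeasurable b μ) {r : ℝ} (hr : 1 ≤ r) :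
    ∫⁻ x, (∫⁻ t, a t * b (x - t) ∂μ) ^ r ∂μ ≤ (∫⁻ t, a t ∂μ) ^ r * ∫⁻ t, b t ^ r ∂μ := by
  have hbr : AEMeasurable (fun t => b t ^ r) μ := by fun_prop
  calc ∫⁻ x, (∫⁻ t, a t * b (x - t) ∂μ) ^ r ∂μ
      ≤ ∫⁻ x, (∫⁻ t, a t ∂μ) ^ (r - 1) * ∫⁻ t, a t * b (x - t) ^ r ∂μ ∂μ := by
        gcongr with x
        exact lintegral_mul_rpow_le ha (hb.comp_quasiMeasurePreserving
          (quasiMeasurePreserving_sub_left_of_right_invariant μ x)) hr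
    _ = (∫⁻ t, a t ∂μ) ^ (r - 1) * ((∫⁻ t, a t ∂μ) * ∫⁻ t, b t ^ r ∂μ) := by
        rw [lintegral_const_mul'' _ (aemeasurable_mul_comp_sub ha hbr).lintegral_prod_right',
          lintegral_lintegral_mul_sub ha hbr]
    _ = (∫⁻ t, a t ∂μ) ^ r * ∫⁻ t, b t ^ r ∂μ := by
        rw [← mul_assoc]
        nth_rw 2 [← ENNReal.rpow_one (∫⁻ t, a t ∂μ)]
        rw [← ENNReal.rpow_add_of_nonneg _ _ (by linarith) zero_le_one, sub_add_cancel]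

theorem eLpNorm_lintegral_mul_sub_le {a b : G → ℝ≥0∞} (ha : AEMeasurable a μ)
    (hb : AEMeasurable b μ) (hp : 1 ≤ p) :
    eLpNorm (fun x => ∫⁻ t, a t * b (x - t) ∂μ) p μ ≤ (∫⁻ t, a t ∂μ) * eLpNorm b p μ := by
  rcases eq_or_ne p ∞ with rfl | hp'
  · rw [eLpNorm_exponent_top, eLpNorm_exponent_top]
    refine eLpNormEssSup_le_of_ae_enorm_bound (Filter.Eventually.of_forall fun x => ?_)
    rw [enorm_eq_self, ← lintegral_mul_const'' _ ha]
    refine lintegral_mono_ae ?_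
    filter_upwards [(quasiMeasurePreserving_sub_left_of_right_invariant μ x).ae
      (enorm_ae_le_eLpNormEssSup b μ)] with t ht
    gcongr
    exact ht
  · have hp₀ : p ≠ 0 := (zero_lt_one.trans_le hp).ne'
    have hr : 1 ≤ p.toReal := by simpa using ENNReal.toReal_mono hp' hp
    rw [eLpNorm_eq_lintegral_rpow_enorm_toReal hp₀ hp',
      eLpNorm_eq_lintegral_rpow_enorm_toReal hp₀ hp']
    simp only [enorm_eq_self, one_div]
    have hr₀ : 0 < p.toReal := by linarith
    calc (∫⁻ x, (∫⁻ t, a t * b (x - t) ∂μ) ^ p.toReal ∂μ) ^ p.toReal⁻¹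
        ≤ ((∫⁻ t, a t ∂μ) ^ p.toReal * ∫⁻ t, b t ^ p.toReal ∂μ) ^ p.toReal⁻¹ := by
          gcongr
          exact lintegral_rpow_lintegral_mul_sub_le ha hb hr
      _ = _ := by
          rw [ENNReal.mul_rpow_of_nonneg _ _ (by positivity), ENNReal.rpow_rpow_inv hr₀.ne']

theorem ae_convolutionExistsAt (hf : Integrable f μ) (hg : MemLp g p μ) (hp : 1 ≤ p) :
    ∀ᵐ x ∂μ, ConvolutionExistsAt f g x L μ := by
  have hf' := hf.aestronglyMeasurable.enorm
  have hg' := hg.aestronglyMeasurable.enorm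
  have hfin : eLpNorm (fun x => ∫⁻ t, ‖f t‖ₑ * ‖g (x - t)‖ₑ ∂μ) p μ < ∞ :=
    (eLpNorm_lintegral_mul_sub_le hf' hg' hp).trans_lt
      (ENNReal.mul_lt_top hf.2 (by simpa only [eLpNorm_enorm] using hg.2))
  filter_upwards [ae_lt_top_of_eLpNorm_lt_top
    (aemeasurable_mul_comp_sub hf' hg').lintegral_prod_right' (zero_lt_one.trans_le hp).ne' hfin]
    with x hx
  refine ⟨L.aestronglyMeasurable_comp₂ hf.aestronglyMeasurable
    (hg.aestronglyMeasurable.comp_quasiMeasurePreserving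
      (quasiMeasurePreserving_sub_left_of_right_invariant μ x)), ?_⟩
  exact (lintegral_enorm_convolution_integrand_le L x).trans_lt
    (ENNReal.mul_lt_top enorm_lt_top hx)

variable [NormedSpace ℝ F]

theorem eLpNorm_convolution_le (hf : AEStronglyMeasurable f μ) (hg : AEStronglyMeasurable g μ)
    (hp : 1 ≤ p) :
    eLpNorm (f ⋆[L, μ] g) p μ ≤ ‖L‖ₑ * eLpNorm f 1 μ * eLpNorm g p μ := by
  have hmajorant := eLpNorm_lintegral_mul_sub_le hf.enorm hg.enorm hp
  rw [eLpNorm_enorm] at hmajorant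
  rw [eLpNorm_one_eq_lintegral_enorm, mul_assoc]
  refine (eLpNorm_le_nnreal_smul_eLpNorm_of_ae_le_mul' (c := ‖L‖₊)
    (g := fun x => ∫⁻ t, ‖f t‖ₑ * ‖g (x - t)‖ₑ ∂μ)
    (Filter.Eventually.of_forall fun x => ?_) p).trans ?_
  · exact (enorm_integral_le_lintegral_enorm _).trans
      (lintegral_enorm_convolution_integrand_le L x)
  · rw [ENNReal.smul_def, smul_eq_mul, ← enorm_eq_nnnorm]
    gcongr

theorem memLp_convolution (hf : Integrable f μ) (hg : MemLp g p μ) (hp : 1 ≤ p) :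
    MemLp (f ⋆[L, μ] g) p μ :=
  ⟨(hf.aestronglyMeasurable.convolution_integrand L hg.aestronglyMeasurable).integral_prod_right',
    (eLpNorm_convolution_le L hf.aestronglyMeasurable hg.aestronglyMeasurable hp).trans_lt
      (ENNReal.mul_lt_top (ENNReal.mul_lt_top enorm_lt_top (memLp_one_iff_integrable.2 hf).2)
        hg.2)⟩

variable [SMulCommClass ℝ 𝕜 F] [Fact (1 ≤ p)]

/-- The convolution `g ↦ f ⋆ g` with an integrable function `f`, as an operator on `L^p`. -/
noncomputable def convLp (hf : Integrable f μ) : Lp E' p μ →L[𝕜] Lp F p μ :=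
  LinearMap.mkContinuous
    { toFun := fun g => (memLp_convolution L hf (Lp.memLp g) Fact.out).toLp _
      map_add' := fun g h => by
        rw [← MemLp.toLp_add, MemLp.toLp_eq_toLp_iff,
          convolution_congr L (Filter.EventuallyEq.refl _ f) (Lp.coeFn_add g h)]
        filter_upwards [ae_convolutionExistsAt L hf (Lp.memLp g) Fact.out,
          ae_convolutionExistsAt L hf (Lp.memLp h) Fact.out] with x hg hh
        exact hg.distrib_add hh
      map_smul' := fun c g => by
        rw [RingHom.id_apply, ← MemLp.toLp_const_smul, MemLp.toLp_eq_toLp_iff,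
          convolution_congr L (Filter.EventuallyEq.refl _ f) (Lp.coeFn_smul c g),
          convolution_smul] }
    (‖L‖ * ∫ x, ‖f x‖ ∂μ) (fun g => by
      have h := eLpNorm_convolution_le L hf.aestronglyMeasurable (Lp.aestronglyMeasurable g)
        (p := p) Fact.out
      rw [LinearMap.coe_mk, AddHom.coe_mk, Lp.norm_toLp, Lp.norm_def, ← toReal_enorm L,
        integral_norm_eq_lintegral_enorm hf.aestronglyMeasurable,
        ← eLpNorm_one_eq_lintegral_enorm, ← ENNReal.toReal_mul, ← ENNReal.toReal_mul]
      exact ENNReal.toReal_mono (ENNReal.mul_lt_top (ENNReal.mul_lt_top enorm_lt_top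
        (memLp_one_iff_integrable.2 hf).2) (Lp.memLp g).2).ne h)

theorem convLp_ae_eq (hf : Integrable f μ) (g : Lp E' p μ) :
    convLp L hf g =ᵐ[μ] f ⋆[L, μ] g :=
  (memLp_convolution L hf (Lp.memLp g) Fact.out).coeFn_toLp

theorem norm_convLp_le (hf : Integrable f μ) :
    ‖convLp (p := p) L hf‖ ≤ ‖L‖ * ∫ x, ‖f x‖ ∂μ :=
  LinearMap.mkContinuous_norm_le _ (by positivity) _

end Young

/-! ### Exponentials of bounded operators -/

section Exponential

variable {𝕜 E F : Type*} [RCLike 𝕜] [NormedAddCommGroup E] [NormedSpace 𝕜 E]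
  [NormedAddCommGroup F] [NormedSpace 𝕜 F]

theorem norm_pow_apply_le (T : E →L[𝕜] E) (n : ℕ) (x : E) : ‖(T ^ n) x‖ ≤ ‖T‖ ^ n * ‖x‖ := by
  induction n with
  | zero => simp
  | succ n ih =>
    rw [pow_succ', pow_succ', mul_assoc]
    exact (T.le_opNorm _).trans (mul_le_mul_of_nonneg_left ih (norm_nonneg T))

variable [CompleteSpace E] [CompleteSpace F]

theorem hasSum_exp_apply (T : E →L[𝕜] E) (x : E) :
    HasSum (fun n : ℕ => ((n.factorial : 𝕜)⁻¹) • (T ^ n) x) (NormedSpace.exp T x) :=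
  (NormedSpace.exp_series_hasSum_exp' (𝕂 := 𝕜) T).mapL (ContinuousLinearMap.apply 𝕜 E x)

theorem norm_exp_apply_le (T : E →L[𝕜] E) (x : E) :
    ‖NormedSpace.exp T x‖ ≤ Real.exp ‖T‖ * ‖x‖ := by
  have hs := (NormedSpace.exp_series_hasSum_exp' (𝕂 := ℝ) ‖T‖).mul_right ‖x‖
  rw [← Real.exp_eq_exp_ℝ] at hs
  refine (hasSum_exp_apply T x).norm_le_of_bounded hs fun n => ?_
  rw [norm_smul, norm_inv, RCLike.norm_natCast, smul_eq_mul, mul_assoc]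
  gcongr
  exact norm_pow_apply_le T n x

theorem exp_smul_one_add_apply (T : E →L[𝕜] E) (c : 𝕜) (x : E) :
    NormedSpace.exp (c • (1 : E →L[𝕜] E) + T) x = NormedSpace.exp c • NormedSpace.exp T x := by
  have hQ : NormedAlgebra ℚ (E →L[𝕜] E) := NormedAlgebra.restrictScalars ℚ 𝕜 _
  rw [← Algebra.algebraMap_eq_smul_one,
    NormedSpace.exp_add_of_commute (Algebra.commutes _ _), ← NormedSpace.algebraMap_exp_comm,
    Algebra.algebraMap_eq_smul_one]
  rfl

theorem exp_apply_mem_of_isClosed {T : E →L[𝕜] E} {S : F →L[𝕜] F} {W : Submodule 𝕜 (E × F)}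
    (hW : IsClosed (W : Set (E × F))) (hTS : ∀ z ∈ W, (T z.1, S z.2) ∈ W) {z : E × F}
    (hz : z ∈ W) : (NormedSpace.exp T z.1, NormedSpace.exp S z.2) ∈ W := by
  have hpow (n : ℕ) : ((T ^ n) z.1, (S ^ n) z.2) ∈ W := by
    induction n with
    | zero => exact hz
    | succ n ih =>
      rw [pow_succ', pow_succ']
      exact hTS _ ih
  have hsum := (hasSum_exp_apply T z.1).prodMk (hasSum_exp_apply S z.2)
  exact hW.mem_of_tendsto hsum (Filter.Eventually.of_forall fun s =>
    W.sum_mem fun n _ => W.smul_mem (n.factorial : 𝕜)⁻¹ (hpow n))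

variable {E : Type*} [NormedAddCommGroup E] [NormedSpace ℝ E] [CompleteSpace E]

theorem map_exp_apply_of_map_apply_eq_smul {F : Type*} [NormedAddCommGroup F] [NormedSpace ℂ F]
    {T : E →L[ℝ] E} {Φ : E →L[ℝ] F} {z : ℂ} (h : ∀ x, Φ (T x) = z • Φ x) (x : E) :
    Φ (NormedSpace.exp T x) = Complex.exp z • Φ x := by
  have hpow (n : ℕ) : Φ ((T ^ n) x) = z ^ n • Φ x := by
    induction n with
    | zero => simp
    | succ n ih =>
      rw [pow_succ', pow_succ', mul_smul, ← ih]
      exact h _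
  refine ((hasSum_exp_apply T x).mapL Φ).unique ?_
  have hz := (NormedSpace.exp_series_hasSum_exp' (𝕂 := ℝ) z).smul_const (Φ x)
  rw [← Complex.exp_eq_exp_ℂ] at hz
  simpa only [map_smul, hpow, smul_assoc] using hz

theorem hasDerivAt_exp_smul_apply (T : E →L[ℝ] E) (x : E) (s : ℝ) :
    HasDerivAt (fun r : ℝ => NormedSpace.exp (r • T) x) (T (NormedSpace.exp (s • T) x)) s := by
  simpa using (hasDerivAt_exp_smul_const' T s).clm_apply (hasDerivAt_const s x)

theorem contDiff_one_exp_smul_apply (T : E →L[ℝ] E) (x : E) :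
    ContDiff ℝ 1 fun r : ℝ => NormedSpace.exp (r • T) x := by
  have hd := hasDerivAt_exp_smul_apply T x
  have hdiff : Differentiable ℝ fun r : ℝ => NormedSpace.exp (r • T) x :=
    fun s => (hd s).differentiableAt
  refine contDiff_one_iff_deriv.2 ⟨hdiff, ?_⟩
  rw [funext fun s => (hd s).deriv]
  exact T.continuous.comp hdiff.continuous

theorem eq_exp_smul_of_deriv_eq (T : E →L[ℝ] E) {u : ℝ → E} (hc : ContinuousOn u (Ici 0))
    (hd : DifferentiableOn ℝ u (Ioi 0)) (he : ∀ t, 0 < t → deriv u t = T (u t)) {t : ℝ}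
    (ht : 0 ≤ t) : u t = NormedSpace.exp (t • T) (u 0) := by
  have hexp := hasDerivAt_exp_smul_apply T (u 0)
  have hc₀ : ContinuousWithinAt u (Ioi 0) 0 := (hc 0 self_mem_Ici).mono Ioi_subset_Ici_self
  have hu : ∀ s ∈ Ico 0 t, HasDerivWithinAt u (T (u s)) (Ici s) s := by
    rintro s ⟨hs, -⟩
    rcases hs.eq_or_lt with rfl | hs
    · refine hasDerivWithinAt_Ici_of_tendsto_deriv hd hc₀ self_mem_nhdsWithin
        (Filter.Tendsto.congr' ?_ ((T.continuous.tendsto _).comp hc₀))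
      filter_upwards [self_mem_nhdsWithin] with s hs using (he s hs).symm
    · rw [← he s hs]
      exact ((hd s hs).differentiableAt (Ioi_mem_nhds hs)).hasDerivAt.hasDerivWithinAt
  exact ODE_solution_unique_of_mem_Icc_right (v := fun _ => T) (s := fun _ => univ) (K := ‖T‖₊)
    (fun _ _ => T.lipschitz.lipschitzOnWith) (hc.mono Icc_subset_Ici_self) hu
    (fun _ _ => mem_univ _) (fun s _ => (hexp s).continuousAt.continuousWithinAt)
    (fun s _ => (hexp s).hasDerivWithinAt) (fun _ _ => mem_univ _) (by simp) ⟨ht, le_rfl⟩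

end Exponential

/-! ### The evolution `γ + k ⋆` and exponential weights -/

section Weighted

variable {α : Type*} [MeasurableSpace α] {μ : Measure α} {𝕜 : Type*} [NormedField 𝕜]

/-- The graph of multiplication by `w`, as a subspace of `L^p × L^q`: the pairs `(F, G)` with
`G = F w` almost everywhere. -/
def weightedPairs (p q : ℝ≥0∞) (μ : Measure α) (w : α → 𝕜) :
    Submodule 𝕜 (Lp 𝕜 p μ × Lp 𝕜 q μ) where
  carrier := {z | z.2 =ᵐ[μ] fun x => z.1 x * w x}
  zero_mem' := by
    filter_upwards [Lp.coeFn_zero 𝕜 p μ, Lp.coeFn_zero 𝕜 q μ] with x h₁ h₂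
    rw [Prod.snd_zero, Prod.fst_zero, h₁, h₂, Pi.zero_apply, zero_mul]
  add_mem' := by
    rintro y z hy hz
    filter_upwards [hy, hz, Lp.coeFn_add y.1 z.1, Lp.coeFn_add y.2 z.2] with x h₁ h₂ h₃ h₄
    rw [Prod.snd_add, Prod.fst_add, h₃, h₄, Pi.add_apply, Pi.add_apply, h₁, h₂, add_mul]
  smul_mem' := by
    rintro c z hz
    filter_upwards [hz, Lp.coeFn_smul c z.1, Lp.coeFn_smul c z.2] with x h₁ h₂ h₃
    rw [Prod.smul_snd, Prod.smul_fst, h₂, h₃, Pi.smul_apply, Pi.smul_apply, h₁, smul_mul_assoc]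

theorem mem_weightedPairs {p q : ℝ≥0∞} {w : α → 𝕜} {z : Lp 𝕜 p μ × Lp 𝕜 q μ} :
    z ∈ weightedPairs p q μ w ↔ z.2 =ᵐ[μ] fun x => z.1 x * w x :=
  Iff.rfl

theorem isClosed_weightedPairs (p q : ℝ≥0∞) [Fact (1 ≤ p)] [Fact (1 ≤ q)] (μ : Measure α)
    (w : α → 𝕜) : IsClosed (weightedPairs p q μ w : Set (Lp 𝕜 p μ × Lp 𝕜 q μ)) := by
  refine IsSeqClosed.isClosed fun z z' hz hlim => ?_
  have hlim₁ := (continuous_fst.tendsto z').comp hlim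
  have hlim₂ := (continuous_snd.tendsto z').comp hlim
  obtain ⟨m, hm, hm_lim⟩ := (tendstoInMeasure_of_tendsto_Lp hlim₁).exists_seq_tendsto_ae
  obtain ⟨l, hl, hl_lim⟩ := (tendstoInMeasure_of_tendsto_Lp
    (hlim₂.comp hm.tendsto_atTop)).exists_seq_tendsto_ae
  filter_upwards [hm_lim, hl_lim, ae_all_iff.2 hz] with x h₁ h₂ h₃
  refine tendsto_nhds_unique h₂ ?_
  simp only [Function.comp_apply, h₃]
  exact (h₁.comp hl.tendsto_atTop).mul_const _

end Weighted

section Generator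

open scoped Convolution

open ContinuousLinearMap (lsmul)

variable {G : Type*} [AddCommGroup G] [MeasurableSpace G] [MeasurableAdd₂ G] [MeasurableNeg G]
  {μ : Measure G} [SFinite μ] [μ.IsAddRightInvariant] {p q : ℝ≥0∞} [Fact (1 ≤ p)] [Fact (1 ≤ q)]
  {k w : G → ℝ} (γ : ℝ)

/-- The bounded operator `F ↦ γ F + k ⋆ F` on `L^p`. -/
noncomputable def generator (hk : Integrable k μ) : Lp ℝ p μ →L[ℝ] Lp ℝ p μ :=
  γ • 1 + convLp (lsmul ℝ ℝ) hk

theorem generator_apply (hk : Integrable k μ) (F : Lp ℝ p μ) :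
    generator γ hk F = γ • F + convLp (lsmul ℝ ℝ) hk F :=
  rfl

theorem norm_exp_smul_generator_apply_le (hk : Integrable k μ) (F : Lp ℝ p μ) {t : ℝ}
    (ht : 0 ≤ t) :
    ‖NormedSpace.exp (t • generator γ hk) F‖ ≤ Real.exp ((γ + ∫ x, ‖k x‖ ∂μ) * t) * ‖F‖ := by
  rw [generator, smul_add, smul_smul, exp_smul_one_add_apply, norm_smul, ← Real.exp_eq_exp_ℝ,
    Real.norm_of_nonneg (Real.exp_pos _).le, add_mul, Real.exp_add, mul_assoc, mul_comm γ t]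
  gcongr
  refine (norm_exp_apply_le _ F).trans ?_
  gcongr
  rw [norm_smul, Real.norm_of_nonneg ht, mul_comm]
  gcongr
  refine (norm_convLp_le _ hk).trans (mul_le_of_le_one_left (by positivity) ?_)
  exact ContinuousLinearMap.opNorm_lsmul_le

variable [μ.IsNegInvariant] [μ.IsAddLeftInvariant]

theorem generator_ae_eq (hk : Integrable k μ) (F : Lp ℝ p μ) :
    generator γ hk F =ᵐ[μ] fun x => γ * F x + ∫ y, k (x - y) * F y ∂μ := by
  rw [generator_apply]
  filter_upwards [Lp.coeFn_add (γ • F) (convLp (lsmul ℝ ℝ) hk F), Lp.coeFn_smul γ F,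
    convLp_ae_eq (lsmul ℝ ℝ) hk F] with x h₁ h₂ h₃
  rw [h₁, Pi.add_apply, h₂, h₃, convolution_lsmul_swap]
  rfl

theorem generator_weight (hw : ∀ x y, w (x + y) = w x * w y) (hk : Integrable k μ)
    (hkw : Integrable (fun x => k x * w x) μ) :
    ∀ z ∈ weightedPairs p q μ w, (generator γ hk z.1, generator γ hkw z.2)
      ∈ weightedPairs p q μ w := by
  intro z hz
  rw [mem_weightedPairs] at hz ⊢
  filter_upwards [generator_ae_eq γ hkw z.2, generator_ae_eq γ hk z.1, hz] with x h₁ h₂ h₃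
  rw [h₁, h₂, h₃, add_mul, mul_assoc, ← integral_mul_const]
  congr 1
  refine integral_congr_ae ?_
  filter_upwards [hz] with y hy
  rw [hy, ← sub_add_cancel x y, hw, add_sub_cancel_right]
  ring

theorem exp_smul_generator_weight (hw : ∀ x y, w (x + y) = w x * w y) (hk : Integrable k μ)
    (hkw : Integrable (fun x => k x * w x) μ) (t : ℝ) {z : Lp ℝ p μ × Lp ℝ q μ}
    (hz : z ∈ weightedPairs p q μ w) :
    (NormedSpace.exp (t • generator γ hk) z.1, NormedSpace.exp (t • generator γ hkw) z.2)
      ∈ weightedPairs p q μ w :=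
  exp_apply_mem_of_isClosed (isClosed_weightedPairs p q μ w)
    (fun z hz => Submodule.smul_mem _ t (generator_weight γ hw hk hkw z hz)) hz

end Generator

section FourierL1

open FourierTransform ContinuousLinearMap
open scoped Convolution

variable {V : Type*} [NormedAddCommGroup V] [InnerProductSpace ℝ V] [FiniteDimensional ℝ V]
  [MeasurableSpace V] [BorelSpace V] {k : V → ℝ}

/-- The Fourier transform at the frequency `w`, as a functional on real-valued `L¹` functions. -/
noncomputable def fourierL1 (w : V) : Lp ℝ 1 (volume : Measure V) →L[ℝ] ℂ :=
  BoundedContinuousFunction.evalCLM ℝ w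
    ∘L (Real.Lp.fourierTransformCLM V ℂ).restrictScalars ℝ ∘L Complex.ofRealCLM.compLpL 1 volume

theorem fourierL1_eq_fourier {F : Lp ℝ 1 (volume : Measure V)} {g : V → ℝ} (h : F =ᵐ[volume] g)
    (w : V) : fourierL1 w F = 𝓕 (fun x => (g x : ℂ)) w := by
  refine Real.fourier_congr_ae ?_ w
  filter_upwards [Complex.ofRealCLM.coeFn_compLpL (p := 1) F, h] with x h₁ h₂
  exact h₁.trans (congrArg _ h₂)

theorem ofReal_convolution (f g : V → ℝ) (x : V) :
    ((f ⋆[lsmul ℝ ℝ] g) x : ℂ) = ((fun y => (f y : ℂ)) ⋆[lsmul ℂ ℂ] fun y => (g y : ℂ)) x := by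
  simp only [convolution_lsmul, smul_eq_mul, ← Complex.ofReal_mul, integral_complex_ofReal]

theorem fourierL1_generator (γ : ℝ) (hk : Integrable k) (w : V)
    (F : Lp ℝ 1 (volume : Measure V)) :
    fourierL1 w (generator γ hk F) = (γ + 𝓕 (fun x => (k x : ℂ)) w) • fourierL1 w F := by
  have hconv := Real.fourier_smul_convolution_eq (hk.ofReal (𝕜 := ℂ))
    ((L1.integrable_coeFn F).ofReal (𝕜 := ℂ)) w
  rw [generator_apply, map_add, map_smul, add_smul, Complex.real_smul,
    fourierL1_eq_fourier (convLp_ae_eq (lsmul ℝ ℝ) hk F), funext (ofReal_convolution k F)]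
  exact congrArg _ (hconv.trans (congrArg _ (fourierL1_eq_fourier .rfl w).symm))

theorem fourierL1_exp_smul_generator (γ : ℝ) (hk : Integrable k) (w : V) (t : ℝ)
    (F : Lp ℝ 1 (volume : Measure V)) :
    fourierL1 w (NormedSpace.exp (t • generator γ hk) F)
      = Complex.exp ((γ + 𝓕 (fun x => (k x : ℂ)) w) * t) * fourierL1 w F := by
  refine map_exp_apply_of_map_apply_eq_smul (fun F => ?_) F
  rw [smul_apply, map_smul, fourierL1_generator, Complex.real_smul,
    mul_comm _ (t : ℂ), mul_smul, smul_eq_mul (t : ℂ)]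

end FourierL1

section Solutions

open FourierTransform

variable {p : ℝ≥0∞} [Fact (1 ≤ p)] {f₀ : ℝ → ℝ} {f : ℝ → Lp ℝ p (volume : Measure ℝ)}

theorem exists_isSolution (hK : Integrable K) (h₀ : MemLp f₀ p) :
    ∃ f : ℝ → Lp ℝ p (volume : Measure ℝ), IsSolution p f₀ f := by
  have hC1 := contDiff_one_exp_smul_apply (generator gamma hK) (h₀.toLp f₀)
  refine ⟨fun t => NormedSpace.exp (t • generator gamma hK) (h₀.toLp f₀),
    hC1.continuous.continuousOn, hC1.contDiffOn, ?_, fun t _ => ?_⟩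
  · simpa using h₀.coeFn_toLp
  · rw [(hasDerivAt_exp_smul_apply (generator gamma hK) (h₀.toLp f₀) t).deriv]
    exact generator_ae_eq gamma hK _

theorem IsSolution.eq_exp (h : IsSolution p f₀ f) (hK : Integrable K) {t : ℝ} (ht : 0 ≤ t) :
    f t = NormedSpace.exp (t • generator gamma hK) (f 0) :=
  eq_exp_smul_of_deriv_eq _ h.continuousOn (h.contDiffOn.differentiableOn one_ne_zero)
    (fun s hs => Lp.ext ((h.equation s hs).trans (generator_ae_eq gamma hK (f s)).symm)) ht

variable {σ : ℝ}

theorem IsSolution.exp_weighted_ae_eq {q : ℝ≥0∞} [Fact (1 ≤ q)] (h : IsSolution p f₀ f)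
    (hK : Integrable K) (hKσ : Integrable fun x => K x * Real.exp (σ * x))
    (h₀ : MemLp (fun x => f₀ x * Real.exp (σ * x)) q) {t : ℝ} (ht : 0 ≤ t) :
    NormedSpace.exp (t • generator gamma hKσ) (h₀.toLp _) =ᵐ[volume]
      fun x => f t x * Real.exp (σ * x) := by
  have hmul (x y : ℝ) : Real.exp (σ * (x + y)) = Real.exp (σ * x) * Real.exp (σ * y) := by
    rw [mul_add, Real.exp_add]
  rw [h.eq_exp hK ht]
  refine exp_smul_generator_weight gamma hmul hK hKσ t (z := (f 0, h₀.toLp _)) ?_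
  filter_upwards [h₀.coeFn_toLp, h.initial] with x h₁ h₂
  rw [h₁, h₂]

theorem IsSolution.memLp_weighted {q : ℝ≥0∞} [Fact (1 ≤ q)] (h : IsSolution p f₀ f)
    (hK : Integrable K) (hKσ : Integrable fun x => K x * Real.exp (σ * x))
    (h₀ : MemLp (fun x => f₀ x * Real.exp (σ * x)) q) {t : ℝ} (ht : 0 ≤ t) :
    MemLp (fun x => f t x * Real.exp (σ * x)) q :=
  (Lp.memLp _).ae_eq (h.exp_weighted_ae_eq hK hKσ h₀ ht)

theorem IsSolution.hat_eq (h : IsSolution p f₀ f) (hK : Integrable K)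
    (hKσ : Integrable fun x => K x * Real.exp (σ * x))
    (h₀ : Integrable fun x => f₀ x * Real.exp (σ * x)) {t : ℝ} (ht : 0 ≤ t) (u : ℝ) :
    hat (f t) (u + σ * Complex.I)
      = Complex.exp (Omega (u + σ * Complex.I) * t) * hat f₀ (u + σ * Complex.I) := by
  have h₁ := memLp_one_iff_integrable.2 h₀
  rw [Omega, hat_line_eq_fourier, hat_line_eq_fourier, hat_line_eq_fourier,
    ← fourierL1_eq_fourier (h.exp_weighted_ae_eq hK hKσ h₁ ht),
    ← fourierL1_eq_fourier h₁.coeFn_toLp]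
  exact fourierL1_exp_smul_generator gamma hKσ _ t _

theorem IsSolution.integral_abs_le (h : IsSolution p f₀ f) (hK : Integrable K)
    (hKσ : Integrable fun x => K x * Real.exp (σ * x))
    (h₀ : Integrable fun x => f₀ x * Real.exp (σ * x)) {t : ℝ} (ht : 0 ≤ t) :
    ∫ x, |f t x| * Real.exp (σ * x)
      ≤ Real.exp ((gamma + ∫ x, |K x| * Real.exp (σ * x)) * t)
        * ∫ x, |f₀ x| * Real.exp (σ * x) := by
  have h₁ := memLp_one_iff_integrable.2 h₀
  have hnorm (g : ℝ → ℝ) (x : ℝ) :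
      |g x| * Real.exp (σ * x) = ‖g x * Real.exp (σ * x)‖ := by
    rw [norm_mul, Real.norm_eq_abs, Real.norm_of_nonneg (Real.exp_pos _).le]
  have hL1 {F : Lp ℝ 1 (volume : Measure ℝ)} {g : ℝ → ℝ}
      (hF : F =ᵐ[volume] fun x => g x * Real.exp (σ * x)) :
      ∫ x, |g x| * Real.exp (σ * x) = ‖F‖ := by
    rw [L1.norm_eq_integral_norm]
    refine integral_congr_ae ?_
    filter_upwards [hF] with x hx
    rw [hx, hnorm]
  rw [hL1 (h.exp_weighted_ae_eq hK hKσ h₁ ht), hL1 h₁.coeFn_toLp]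
  simp only [hnorm]
  exact norm_exp_smul_generator_apply_le gamma hKσ _ ht

end Solutions

/-! ### The spaces `X_{A,B}` -/

section SpaceX

theorem memLp_exp_mul_Ioi {c : ℝ} (hc : c < 0) (a : ℝ) (q : ℝ≥0∞) :
    MemLp (fun x : ℝ => Real.exp (c * x)) q (volume.restrict (Ioi a)) := by
  have hmeas : AEStronglyMeasurable (fun x : ℝ => Real.exp (c * x)) (volume.restrict (Ioi a)) := by
    fun_prop
  rcases eq_or_ne q 0 with rfl | hq₀
  · exact memLp_zero_iff_aestronglyMeasurable.2 hmeas
  rcases eq_or_ne q ∞ with rfl | hq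
  · refine memLp_top_of_bound hmeas (Real.exp (c * a)) ?_
    filter_upwards [ae_restrict_mem measurableSet_Ioi] with x hx
    rw [Real.norm_of_nonneg (Real.exp_pos _).le, Real.exp_le_exp]
    exact mul_le_mul_of_nonpos_left (mem_Ioi.1 hx).le hc.le
  · rw [← integrable_norm_rpow_iff hmeas hq₀ hq]
    have hint := integrableOn_exp_mul_Ioi
      (mul_neg_of_neg_of_pos hc (ENNReal.toReal_pos hq₀ hq)) a
    refine hint.congr (Filter.Eventually.of_forall fun x => ?_)
    simp only [Real.norm_of_nonneg (Real.exp_pos _).le, ← Real.exp_mul]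
    ring_nf

theorem memLp_exp_mul_Iio {c : ℝ} (hc : 0 < c) (a : ℝ) (q : ℝ≥0∞) :
    MemLp (fun x : ℝ => Real.exp (c * x)) q (volume.restrict (Iio a)) := by
  have hneg : MeasurePreserving Neg.neg (volume.restrict (Iio a)) (volume.restrict (Ioi (-a))) := by
    simpa using (Measure.measurePreserving_neg (volume : Measure ℝ)).restrict_preimage
      (measurableSet_Ioi (a := -a))
  simpa [Function.comp_def] using
    (memLp_exp_mul_Ioi (neg_lt_zero.2 hc) (-a) q).comp_measurePreserving hneg

variable {A B D σ : ℝ} {g : ℝ → ℝ} {q : ℝ≥0∞}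

theorem memLp_mul_exp_of_memLp_top {μ : Measure ℝ}
    (hg : MemLp (fun x => Real.exp (-D * x) * g x) ∞ μ)
    (hexp : MemLp (fun x => Real.exp ((D + σ) * x)) q μ) :
    MemLp (fun x => g x * Real.exp (σ * x)) q μ := by
  refine (hexp.mul' hg).ae_eq (Filter.Eventually.of_forall fun x => ?_)
  simp only
  rw [mul_right_comm, ← Real.exp_add, mul_comm]
  ring_nf

theorem MemX.aestronglyMeasurable (h : MemX A B g) : AEStronglyMeasurable g := by
  rw [← Measure.restrict_univ (μ := (volume : Measure ℝ)), ← iUnion_compactCovering ℝ,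
    aestronglyMeasurable_iUnion_iff]
  exact fun n => (h.1 _ (isCompact_compactCovering ℝ n)).1

theorem MemX.memLp_weighted (h : MemX A B g) (hA : -A < σ) (hB : σ < -B) :
    MemLp (fun x => g x * Real.exp (σ * x)) q := by
  have hmeas (D : ℝ) : AEStronglyMeasurable fun x => Real.exp (-D * x) * g x :=
    AEStronglyMeasurable.mul (by fun_prop) h.aestronglyMeasurable
  obtain ⟨hA_top, hB_top⟩ := ENNReal.add_lt_top.1 h.2
  have hneg : MemLp (fun x => g x * Real.exp (σ * x)) q (volume.restrict (Iio 0)) :=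
    memLp_mul_exp_of_memLp_top ⟨(hmeas A).restrict, hA_top⟩
      (memLp_exp_mul_Iio (by linarith) 0 q)
  have hpos : MemLp (fun x => g x * Real.exp (σ * x)) q (volume.restrict (Ioi 0)) :=
    memLp_mul_exp_of_memLp_top ⟨(hmeas B).restrict, hB_top⟩
      (memLp_exp_mul_Ioi (by linarith) 0 q)
  rw [restrict_Ioi_eq_restrict_Ici, ← compl_Iio] at hpos
  classical
  simpa only [piecewise_same] using MemLp.piecewise measurableSet_Iio hneg hpos

end SpaceX

/-! ### The kernel: closed form, symmetry and positivity -/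

section InverseFunctions

theorem artanh_div_sqrt_one_add_sq (p : ℝ) : Real.artanh (p / √(1 + p ^ 2)) = Real.arsinh p := by
  rw [← Real.artanh_tanh (Real.arsinh p), Real.tanh_eq_sinh_div_cosh, Real.sinh_arsinh,
    Real.cosh_arsinh]

theorem self_le_arcsin {p : ℝ} (h₀ : 0 ≤ p) (h₁ : p ≤ 1) : p ≤ Real.arcsin p := by
  have h := Real.sin_le (Real.arcsin_nonneg.2 h₀)
  rwa [Real.sin_arcsin (by linarith) h₁] at h

theorem arsinh_le_self {p : ℝ} (h₀ : 0 ≤ p) : Real.arsinh p ≤ p := by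
  have h := Real.self_le_sinh_iff.2 (Real.arsinh_nonneg_iff.2 h₀)
  rwa [Real.sinh_arsinh] at h

theorem div_sqrt_one_add_sq_le_arsinh {p : ℝ} (h₀ : 0 < p) :
    p / √(1 + p ^ 2) ≤ Real.arsinh p := by
  obtain ⟨c, ⟨hc₀, hcp⟩, hc⟩ := exists_hasDerivAt_eq_slope Real.arsinh
    (fun x => (√(1 + x ^ 2))⁻¹) h₀ Real.continuous_arsinh.continuousOn
    fun x _ => Real.hasDerivAt_arsinh x
  rw [Real.arsinh_zero, sub_zero, sub_zero, eq_div_iff h₀.ne'] at hc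
  rw [← hc, div_eq_inv_mul]
  have : 0 < 1 + c ^ 2 := by positivity
  gcongr

theorem arcsin_eq_two_mul_arctan {p : ℝ} (h₀ : -1 < p) (h₁ : p < 1) :
    Real.arcsin p = 2 * Real.arctan (p / (1 + √(1 - p ^ 2))) := by
  have h2 : 0 < 1 - p ^ 2 := by nlinarith
  have hs : 0 < √(1 - p ^ 2) := Real.sqrt_pos.2 h2
  have hss : √(1 - p ^ 2) ^ 2 = 1 - p ^ 2 := Real.sq_sqrt h2.le
  rw [Real.arcsin_eq_arctan ⟨h₀, h₁⟩]
  set s := √(1 - p ^ 2)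
  rw [Real.two_mul_arctan (by rw [lt_div_iff₀ (by positivity)]; linarith)
    (by rw [div_lt_one (by positivity)]; linarith)]
  have hden : 1 - (p / (1 + s)) ^ 2 = 2 * s / (1 + s) := by
    field_simp
    linear_combination -hss
  rw [hden]
  field_simp

theorem arcsin_le_add_pow_three {p : ℝ} (h₀ : 0 ≤ p) (h₁ : p < 1) :
    Real.arcsin p ≤ p + p ^ 3 := by
  have hs : 0 ≤ √(1 - p ^ 2) := Real.sqrt_nonneg _
  have hss : √(1 - p ^ 2) ^ 2 = 1 - p ^ 2 := Real.sq_sqrt (by nlinarith)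
  have hs₁ : √(1 - p ^ 2) ≤ 1 := by rw [Real.sqrt_le_one]; nlinarith
  rw [arcsin_eq_two_mul_arctan (by linarith) h₁]
  set s := √(1 - p ^ 2)
  have harctan : Real.arctan (p / (1 + s)) ≤ p / (1 + s) := by
    have h := Real.le_tan (Real.arctan_nonneg.2 (show 0 ≤ p / (1 + s) by positivity))
      (Real.arctan_lt_pi_div_two _)
    rwa [Real.tan_arctan] at h
  have hhalf : p / (1 + s) ≤ (p + p ^ 3) / 2 := by
    rw [div_le_div_iff₀ (by positivity) two_pos]
    have hp : p ^ 2 = 1 - s ^ 2 := by linarith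
    have : 2 ≤ (1 + p ^ 2) * (1 + s) := by
      rw [hp]
      nlinarith [mul_nonneg hs (sub_nonneg.2 hs₁), mul_nonneg (mul_nonneg hs hs) (sub_nonneg.2 hs₁)]
    nlinarith
  linarith

theorem measurable_artanh : Measurable Real.artanh := by
  unfold Real.artanh
  fun_prop

end InverseFunctions

section ClosedForm

/-- The elementary summand of `kernelV p` for `p < 1`: the two logarithmic terms combined. -/
noncomputable def logPart (p : ℝ) : ℝ :=
  -(4 * p ^ 2 * Real.log p) / (1 - p ^ 4)

/-- The summand of `kernelV p` for `p < 1` formed by the inverse circular and hyperbolic functions,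
written with `arcsin` and `arsinh`. -/
noncomputable def arcPart (p : ℝ) : ℝ :=
  2 / p * (Real.arcsin p / √(1 - p ^ 2) - Real.arsinh p / √(1 + p ^ 2))

theorem kernelV_of_lt_one {p : ℝ} (h₀ : 0 < p) (h₁ : p < 1) :
    kernelV p = logPart p + arcPart p := by
  have h2 : 0 < 1 - p ^ 2 := by nlinarith
  have hs : √(1 - p ^ 2) ≠ 0 := (Real.sqrt_pos.2 h2).ne'
  have hr : √(1 + p ^ 2) ≠ 0 := (Real.sqrt_pos.2 (by positivity)).ne'
  have h4 : 1 - p ^ 4 = (1 - p ^ 2) * (1 + p ^ 2) := by ring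
  rw [kernelV, kernelR, kernelS, if_pos h₁, if_pos h₁, artanh_div_sqrt_one_add_sq, logPart,
    arcPart, Real.arcsin_eq_arctan ⟨by linarith, h₁⟩, h4]
  replace h2 := h2.ne'
  field_simp
  ring

theorem kernelV_of_one_lt {p : ℝ} (h : 1 < p) : kernelV p = kernelV p⁻¹ / p ^ 3 := by
  have hp₀ : 0 < p := by linarith
  have hp : ¬ p < 1 := by linarith
  have hinv : p⁻¹ < 1 := inv_lt_one_of_one_lt₀ h
  have h2 : 0 < p ^ 2 - 1 := by nlinarith
  have hs : √(p ^ 2 - 1) ≠ 0 := (Real.sqrt_pos.2 h2).ne'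
  have hr : √(1 + p ^ 2) ≠ 0 := (Real.sqrt_pos.2 (by positivity)).ne'
  have hadd : 1 + p⁻¹ ^ 2 = (1 + p ^ 2) / p ^ 2 := by
    field_simp
    ring
  have hsub : 1 - p⁻¹ ^ 2 = (p ^ 2 - 1) / p ^ 2 := by field_simp
  rw [kernelV, kernelR, kernelS, if_neg hp, if_neg hp, if_pos h, if_pos h, kernelV, kernelR,
    kernelS, if_pos hinv, if_pos hinv, hadd, hsub, Real.sqrt_div (by positivity),
    Real.sqrt_div h2.le, Real.sqrt_sq hp₀.le, Real.log_inv,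
    show p⁻¹ / (√(1 + p ^ 2) / p) = 1 / √(1 + p ^ 2) by field_simp,
    show p⁻¹ / (√(p ^ 2 - 1) / p) = 1 / √(p ^ 2 - 1) by field_simp]
  replace h2 := h2.ne'
  field_simp
  ring

theorem logPart_pos {p : ℝ} (h₀ : 0 < p) (h₁ : p < 1) : 0 < logPart p := by
  have h4 : p ^ 4 < 1 := pow_lt_one₀ h₀.le h₁ (by norm_num)
  have hlog : 0 < -Real.log p := neg_pos.2 (Real.log_neg h₀ h₁)
  rw [logPart, ← mul_neg]
  exact div_pos (by positivity) (by linarith)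

theorem arcPart_nonneg {p : ℝ} (h₀ : 0 < p) (h₁ : p < 1) : 0 ≤ arcPart p := by
  have hs : 0 < √(1 - p ^ 2) := Real.sqrt_pos.2 (by nlinarith)
  have hs₁ : √(1 - p ^ 2) ≤ 1 := by rw [Real.sqrt_le_one]; nlinarith
  have hr : 1 ≤ √(1 + p ^ 2) := by rw [Real.one_le_sqrt]; nlinarith
  have harcsin : p ≤ Real.arcsin p / √(1 - p ^ 2) := by
    rw [le_div_iff₀ hs]
    nlinarith [self_le_arcsin h₀.le h₁.le]
  have harsinh : Real.arsinh p / √(1 + p ^ 2) ≤ p := by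
    rw [div_le_iff₀ (by linarith)]
    nlinarith [arsinh_le_self h₀.le]
  exact mul_nonneg (by positivity) (by linarith)

theorem arcPart_le {p : ℝ} (h₀ : 0 < p) (h₁ : p < 1) : arcPart p ≤ 6 * p ^ 2 / √(1 - p ^ 2) := by
  have hs : 0 < √(1 - p ^ 2) := Real.sqrt_pos.2 (by nlinarith)
  have hss : √(1 - p ^ 2) ^ 2 = 1 - p ^ 2 := Real.sq_sqrt (by nlinarith)
  have hs₁ : √(1 - p ^ 2) ≤ 1 := by rw [Real.sqrt_le_one]; nlinarith
  have hrr : √(1 + p ^ 2) ^ 2 = 1 + p ^ 2 := Real.sq_sqrt (by positivity)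
  have harsinh : p - p ^ 3 ≤ Real.arsinh p / √(1 + p ^ 2) := by
    calc p - p ^ 3 ≤ p / (1 + p ^ 2) := by
          rw [le_div_iff₀ (by positivity)]
          nlinarith [pow_pos h₀ 5]
      _ = p / √(1 + p ^ 2) / √(1 + p ^ 2) := by rw [div_div, ← sq, hrr]
      _ ≤ Real.arsinh p / √(1 + p ^ 2) := by
          gcongr
          exact div_sqrt_one_add_sq_le_arsinh h₀
  rw [arcPart]
  set s := √(1 - p ^ 2)
  have harcsin : Real.arcsin p / s ≤ (p + p ^ 3) / s := by
    gcongr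
    exact arcsin_le_add_pow_three h₀.le h₁
  have hdiff : (p + p ^ 3) / s - (p - p ^ 3) ≤ 3 * p ^ 3 / s := by
    have hs₂ : 1 - s ≤ p ^ 2 := by nlinarith
    rw [sub_le_iff_le_add, div_add' _ _ _ hs.ne', div_le_div_iff_of_pos_right hs]
    nlinarith [pow_pos h₀ 3]
  calc 2 / p * (Real.arcsin p / s - Real.arsinh p / √(1 + p ^ 2))
      ≤ 2 / p * (3 * p ^ 3 / s) := by
        gcongr
        linarith
    _ = 6 * p ^ 2 / s := by
        field_simp
        norm_num

end ClosedForm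

section Kernel

theorem K_eq_logPart_add_arcPart {x : ℝ} (hx : x < 0) :
    K x = logPart (Real.exp (x / 2)) + arcPart (Real.exp (x / 2)) :=
  kernelV_of_lt_one (Real.exp_pos _) (Real.exp_lt_one_iff.2 (by linarith))

theorem K_neg (x : ℝ) : K (-x) = Real.exp (3 * x / 2) * K x := by
  have hpos (x : ℝ) (hx : 0 < x) : K (-x) = Real.exp (3 * x / 2) * K x := by
    rw [K, K, kernelV_of_one_lt (Real.one_lt_exp_iff.2 (by linarith : 0 < x / 2)), ← Real.exp_neg,
      ← Real.exp_nat_mul, neg_div,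
      show ((3 : ℕ) : ℝ) * (x / 2) = 3 * x / 2 by push_cast; ring,
      mul_div_cancel₀ _ (Real.exp_pos _).ne']
  rcases lt_trichotomy x 0 with hx | rfl | hx
  · have h := hpos (-x) (by linarith)
    rw [neg_neg] at h
    rw [h, ← mul_assoc, ← Real.exp_add, show 3 * x / 2 + 3 * -x / 2 = 0 by ring, Real.exp_zero,
      one_mul]
  · simp
  · exact hpos x hx

theorem K_neg_mul_exp (σ x : ℝ) :
    K (-x) * Real.exp (σ * -x) = K x * Real.exp ((3 / 2 - σ) * x) := by
  rw [K_neg, mul_right_comm, ← Real.exp_add, mul_comm]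
  ring_nf

theorem K_pos {x : ℝ} (hx : x ≠ 0) : 0 < K x := by
  have hneg (x : ℝ) (hx : x < 0) : 0 < K x := by
    have h₁ : Real.exp (x / 2) < 1 := Real.exp_lt_one_iff.2 (by linarith)
    rw [K_eq_logPart_add_arcPart hx]
    exact add_pos_of_pos_of_nonneg (logPart_pos (Real.exp_pos _) h₁)
      (arcPart_nonneg (Real.exp_pos _) h₁)
  rcases lt_or_gt_of_ne hx with hx | hx
  · exact hneg x hx
  · have h := hneg (-x) (by linarith)
    rw [K_neg] at h
    exact (mul_pos_iff_of_pos_left (Real.exp_pos _)).1 h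

theorem K_nonneg (x : ℝ) : 0 ≤ K x := by
  obtain rfl | hx := eq_or_ne x 0
  · simp [K, kernelV, kernelR, kernelS]
  · exact (K_pos hx).le

theorem measurable_K : Measurable K := by
  have hartanh := measurable_artanh
  have hR : Measurable kernelR := by
    unfold kernelR
    exact Measurable.ite measurableSet_Iio (by fun_prop)
      (Measurable.ite measurableSet_Ioi (by fun_prop) measurable_const)
  have hS : Measurable kernelS := by
    unfold kernelS
    exact Measurable.ite measurableSet_Iio (by fun_prop)
      (Measurable.ite measurableSet_Ioi (by fun_prop) measurable_const)
  have hV : Measurable kernelV := hR.add hS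
  unfold K
  fun_prop

theorem neg_mul_exp_le_one_sub_exp {δ x : ℝ} (hδ₁ : δ ≤ 1) (hx : x ≤ 0) :
    -(δ * x) * Real.exp (δ * x) ≤ 1 - Real.exp x := by
  have hmono : Real.exp x ≤ Real.exp (δ * x) := Real.exp_le_exp.2 (by nlinarith)
  have htangent := Real.add_one_le_exp (-(δ * x))
  have hinv : Real.exp (-(δ * x)) * Real.exp (δ * x) = 1 := by
    rw [← Real.exp_add, neg_add_cancel, Real.exp_zero]
  nlinarith [Real.exp_pos (δ * x)]

theorem logPart_exp_half_le {δ x : ℝ} (hδ : 0 < δ) (hδ₁ : δ ≤ 1) (hx : x < 0) :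
    logPart (Real.exp (x / 2)) ≤ 2 / δ * Real.exp ((1 - δ) * x) := by
  have h2x : Real.exp (2 * x) ≤ Real.exp x := Real.exp_le_exp.2 (by linarith)
  have hlow := neg_mul_exp_le_one_sub_exp hδ₁ hx.le
  have h1 : 0 < 1 - Real.exp x := sub_pos.2 (Real.exp_lt_one_iff.2 hx)
  have e2 : Real.exp (x / 2) ^ 2 = Real.exp ((1 - δ) * x) * Real.exp (δ * x) := by
    rw [← Real.exp_nat_mul, ← Real.exp_add]
    push_cast
    ring_nf
  have e4 : Real.exp (x / 2) ^ 4 = Real.exp (2 * x) := by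
    rw [← Real.exp_nat_mul]
    push_cast
    ring_nf
  rw [logPart, Real.log_exp, e2, e4, div_le_iff₀ (by linarith)]
  calc -(4 * (Real.exp ((1 - δ) * x) * Real.exp (δ * x)) * (x / 2))
      = 2 / δ * Real.exp ((1 - δ) * x) * (-(δ * x) * Real.exp (δ * x)) := by
        field_simp
        ring
    _ ≤ 2 / δ * Real.exp ((1 - δ) * x) * (1 - Real.exp (2 * x)) := by
        gcongr
        linarith

theorem arcPart_exp_half_le {δ x : ℝ} (hδ : 0 < δ) (hδ₁ : δ ≤ 1) (hx : x < 0) :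
    arcPart (Real.exp (x / 2))
      ≤ 6 / √δ * ((-x) ^ (-(1 / 2) : ℝ) * Real.exp ((1 - δ) * x)) := by
  have h1 : 0 < 1 - Real.exp x := sub_pos.2 (Real.exp_lt_one_iff.2 hx)
  have hsx : 0 < √(-x) := Real.sqrt_pos.2 (by linarith)
  have hroot : √δ * √(-x) * Real.exp (δ * x) ≤ √(1 - Real.exp x) := by
    refine Real.le_sqrt_of_sq_le ((?_ : _ ≤ _).trans (neg_mul_exp_le_one_sub_exp hδ₁ hx.le))
    have hδx : Real.exp (δ * x) ≤ 1 := Real.exp_le_one_iff.2 (by nlinarith)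
    rw [mul_pow, mul_pow, Real.sq_sqrt hδ.le, Real.sq_sqrt (by linarith), ← mul_neg]
    have hδx₀ : 0 ≤ δ * -x := mul_nonneg hδ.le (by linarith)
    gcongr
    exact pow_le_of_le_one (Real.exp_pos _).le hδx two_ne_zero
  have e2 : Real.exp (x / 2) ^ 2 = Real.exp x := by
    rw [← Real.exp_nat_mul]
    push_cast
    ring_nf
  have hsplit : Real.exp x = Real.exp ((1 - δ) * x) * Real.exp (δ * x) := by
    rw [← Real.exp_add]
    ring_nf
  refine (arcPart_le (Real.exp_pos _) (Real.exp_lt_one_iff.2 (by linarith))).trans ?_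
  rw [e2, Real.rpow_neg (by linarith), ← Real.sqrt_eq_rpow, div_le_iff₀ (Real.sqrt_pos.2 h1)]
  calc 6 * Real.exp x
      = 6 / √δ * ((√(-x))⁻¹ * Real.exp ((1 - δ) * x)) * (√δ * √(-x) * Real.exp (δ * x)) := by
        rw [hsplit]
        field_simp
    _ ≤ _ := by gcongr

theorem integrableOn_K_mul_exp_Iio {σ : ℝ} (hσ : -1 < σ) :
    IntegrableOn (fun x => K x * Real.exp (σ * x)) (Iio 0) := by
  obtain ⟨δ, hδ, hδ₁, hc⟩ : ∃ δ : ℝ, 0 < δ ∧ δ ≤ 1 ∧ 0 < 1 - δ + σ :=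
    ⟨min 1 ((1 + σ) / 2), lt_min one_pos (by linarith), min_le_left _ _, by
      linarith [min_le_right 1 ((1 + σ) / 2)]⟩
  have hlog : IntegrableOn (fun x : ℝ => Real.exp ((1 - δ + σ) * x)) (Iio 0) :=
    (integrableOn_exp_mul_Iic hc 0).mono_set Iio_subset_Iic_self
  have harc : IntegrableOn (fun x : ℝ => (-x) ^ (-(1 / 2) : ℝ) * Real.exp ((1 - δ + σ) * x))
      (Iio 0) := by
    have h := integrableOn_rpow_mul_exp_neg_mul_rpow (p := 1) (s := -(1 / 2)) (b := 1 - δ + σ)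
      (by norm_num) (by norm_num) hc
    rw [← neg_zero] at h
    refine h.comp_neg_Iio.congr_fun (fun x _ => ?_) measurableSet_Iio
    simp only [Real.rpow_one, neg_mul, mul_neg, neg_neg]
  refine ((hlog.const_mul (2 / δ)).add (harc.const_mul (6 / √δ))).mono'
    ((measurable_K.mul (by fun_prop)).aestronglyMeasurable)
    (ae_restrict_of_forall_mem measurableSet_Iio fun x hx => ?_)
  rw [Real.norm_of_nonneg (mul_nonneg (K_nonneg x) (Real.exp_pos _).le),
    K_eq_logPart_add_arcPart hx]
  calc _ ≤ (2 / δ * Real.exp ((1 - δ) * x)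
          + 6 / √δ * ((-x) ^ (-(1 / 2) : ℝ) * Real.exp ((1 - δ) * x))) * Real.exp (σ * x) := by
        gcongr
        exacts [logPart_exp_half_le hδ hδ₁ hx, arcPart_exp_half_le hδ hδ₁ hx]
    _ = _ := by
        rw [Pi.add_apply, add_mul (1 - δ) σ x, Real.exp_add]
        ring

theorem integrable_K_mul_exp {σ : ℝ} (h₁ : -1 < σ) (h₂ : σ < 5 / 2) :
    Integrable fun x => K x * Real.exp (σ * x) := by
  have hpos : IntegrableOn (fun x => K x * Real.exp (σ * x)) (Ioi 0) := by
    have h := integrableOn_K_mul_exp_Iio (σ := 3 / 2 - σ) (by linarith)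
    rw [← neg_zero] at h
    refine h.comp_neg_Ioi.congr_fun (fun x _ => ?_) measurableSet_Ioi
    simp only [K_neg_mul_exp, sub_sub_cancel]
  have h := ((integrableOn_Iic_iff_integrableOn_Iio (by finiteness)).2
    (integrableOn_K_mul_exp_Iio h₁)).union hpos
  rwa [Iic_union_Ioi, integrableOn_univ] at h

theorem integrable_K : Integrable K := by
  simpa using integrable_K_mul_exp (σ := 0) (by norm_num) (by norm_num)

theorem integral_K_mul_exp_three_halves_sub (σ : ℝ) :
    ∫ x, K x * Real.exp ((3 / 2 - σ) * x) = ∫ x, K x * Real.exp (σ * x) := by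
  rw [← integral_neg_eq_self fun x => K x * Real.exp (σ * x)]
  simp_rw [K_neg_mul_exp]

theorem strictConvexOn_integral_K_mul_exp :
    StrictConvexOn ℝ (Ioo (-1) (5 / 2)) fun σ => ∫ x, K x * Real.exp (σ * x) := by
  refine ⟨convex_Ioo _ _, fun σ hσ τ hτ hne a b ha hb hab => ?_⟩
  have hi {ρ : ℝ} (hρ : ρ ∈ Ioo (-1 : ℝ) (5 / 2)) := integrable_K_mul_exp hρ.1 hρ.2
  have hmem : a • σ + b • τ ∈ Ioo (-1 : ℝ) (5 / 2) := convex_Ioo _ _ hσ hτ ha.le hb.le hab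
  have hcomb : Integrable fun x => a * (K x * Real.exp (σ * x)) + b * (K x * Real.exp (τ * x)) :=
    ((hi hσ).const_mul a).add ((hi hτ).const_mul b)
  have hlt {x : ℝ} (hx : x ≠ 0) : K x * Real.exp ((a • σ + b • τ) * x)
      < a * (K x * Real.exp (σ * x)) + b * (K x * Real.exp (τ * x)) := by
    have h := strictConvexOn_exp.2 (mem_univ (σ * x)) (mem_univ (τ * x))
      (fun h => hne (mul_right_cancel₀ hx h)) ha hb hab
    simp only [smul_eq_mul] at h ⊢
    calc K x * Real.exp ((a * σ + b * τ) * x)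
        = K x * Real.exp (a * (σ * x) + b * (τ * x)) := by ring_nf
      _ < K x * (a * Real.exp (σ * x) + b * Real.exp (τ * x)) :=
          mul_lt_mul_of_pos_left h (K_pos hx)
      _ = _ := by ring
  have hae : ∀ᵐ x : ℝ, x ≠ 0 := by simp [ae_iff]
  have hpos : 0 < ∫ x, (a * (K x * Real.exp (σ * x)) + b * (K x * Real.exp (τ * x)))
      - K x * Real.exp ((a • σ + b • τ) * x) := by
    rw [integral_pos_iff_support_of_nonneg_ae
      (hae.mono fun x hx => (sub_pos.2 (hlt hx)).le) (hcomb.sub (hi hmem))]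
    refine lt_of_lt_of_le (by simp) (measure_mono (s := Ioi 0) fun x hx => ?_)
    exact (sub_pos.2 (hlt (ne_of_gt hx))).ne'
  rw [integral_sub hcomb (hi hmem), integral_add ((hi hσ).const_mul a) ((hi hτ).const_mul b),
    integral_const_mul, integral_const_mul] at hpos
  simpa only [smul_eq_mul, sub_pos] using hpos

end Kernel

/-! ### The odd dilogarithms -/

section OddDilog

/-- The power series `∑ εⁿ x²ⁿ⁺¹ / (2n + 1)²`. For `ε = 1` it is Legendre's `χ₂`, for `ε = -1` the
inverse tangent integral, whose value at `1` is Catalan's constant. -/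
noncomputable def oddDilog (ε x : ℝ) : ℝ := ∑' n : ℕ, ε ^ n * x ^ (2 * n + 1) / (2 * n + 1) ^ 2

theorem summable_one_div_odd_sq : Summable fun n : ℕ => 1 / (2 * (n : ℝ) + 1) ^ 2 := by
  have h := (Real.summable_one_div_nat_pow.2 one_lt_two).comp_injective
    (i := fun n : ℕ => 2 * n + 1) fun a b hab => by simpa using hab
  exact h.congr fun n => by simp

theorem tsum_one_div_odd_sq : ∑' n : ℕ, 1 / (2 * (n : ℝ) + 1) ^ 2 = Real.pi ^ 2 / 8 := by
  have heven : HasSum (fun n : ℕ => 1 / ((2 * n : ℕ) : ℝ) ^ 2) (Real.pi ^ 2 / 6 / 4) :=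
    (hasSum_zeta_two.div_const 4).congr_fun fun n => by
      push_cast
      rw [mul_pow, div_div, mul_comm]
      norm_num
  have hodd : HasSum (fun n : ℕ => 1 / ((2 * n + 1 : ℕ) : ℝ) ^ 2)
      (∑' n : ℕ, 1 / (2 * (n : ℝ) + 1) ^ 2) :=
    summable_one_div_odd_sq.hasSum.congr_fun fun n => by push_cast; rfl
  have h := (heven.even_add_odd (f := fun n : ℕ => 1 / (n : ℝ) ^ 2) hodd).unique hasSum_zeta_two
  linarith

theorem oddDilog_zero (ε : ℝ) : oddDilog ε 0 = 0 := by
  simp [oddDilog]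

theorem oddDilog_one_one : oddDilog 1 1 = Real.pi ^ 2 / 8 := by
  simp only [oddDilog, one_pow, one_mul]
  exact tsum_one_div_odd_sq

theorem oddDilog_neg_one_one : oddDilog (-1) 1 = catalanG := by
  simp [oddDilog, catalanG]

theorem continuousOn_oddDilog {ε : ℝ} (hε : |ε| ≤ 1) : ContinuousOn (oddDilog ε) (Icc (-1) 1) := by
  refine continuousOn_tsum (fun n => by fun_prop) summable_one_div_odd_sq fun n x hx => ?_
  rw [norm_div, norm_mul, norm_pow, norm_pow, Real.norm_eq_abs, Real.norm_eq_abs,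
    Real.norm_of_nonneg (by positivity)]
  gcongr
  exact mul_le_one₀ (pow_le_one₀ (abs_nonneg _) hε) (by positivity)
    (pow_le_one₀ (abs_nonneg _) (abs_le.2 hx))

theorem hasDerivAt_oddDilog {ε x : ℝ} (hε : |ε| ≤ 1) (hx : |x| < 1) :
    HasDerivAt (oddDilog ε) (∑' n : ℕ, ε ^ n * x ^ (2 * n) / (2 * n + 1)) x := by
  obtain ⟨r, hxr, hr⟩ := exists_between hx
  have hr₀ : 0 < r := (abs_nonneg x).trans_lt hxr
  refine hasDerivAt_tsum_of_isPreconnected (t := Ioo (-r) r) (y₀ := 0)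
    (u := fun n : ℕ => (r ^ 2) ^ n)
    (g := fun (n : ℕ) (x : ℝ) => ε ^ n * x ^ (2 * n + 1) / (2 * n + 1) ^ 2)
    (g' := fun (n : ℕ) (x : ℝ) => ε ^ n * x ^ (2 * n) / (2 * n + 1))
    (summable_geometric_of_lt_one (by positivity) (pow_lt_one₀ hr₀.le hr two_ne_zero))
    isOpen_Ioo isPreconnected_Ioo (fun n y _ => ?_) (fun n y hy => ?_) ⟨by linarith, hr₀⟩
    (summable_zero.congr fun n => by simp) (abs_lt.1 hxr)
  · have h := ((hasDerivAt_pow (2 * n + 1) y).const_mul (ε ^ n)).div_const ((2 * (n : ℝ) + 1) ^ 2)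
    refine h.congr_deriv ?_
    have : 2 * (n : ℝ) + 1 ≠ 0 := by positivity
    push_cast
    field_simp
  · rw [norm_div, norm_mul, norm_pow, norm_pow, Real.norm_eq_abs, Real.norm_eq_abs,
      Real.norm_of_nonneg (by positivity), ← pow_mul]
    calc |ε| ^ n * |y| ^ (2 * n) / (2 * n + 1) ≤ 1 * r ^ (2 * n) / 1 := by
          gcongr
          exacts [pow_le_one₀ (abs_nonneg _) hε, (abs_lt.2 hy).le,
            le_add_of_nonneg_left (by positivity)]
      _ = r ^ (2 * n) := by rw [one_mul, div_one]

theorem hasDerivAt_oddDilog_neg_one {x : ℝ} (hx₀ : x ≠ 0) (hx : |x| < 1) :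
    HasDerivAt (oddDilog (-1)) (Real.arctan x / x) x := by
  have hsum : HasSum (fun n : ℕ => (-1 : ℝ) ^ n * x ^ (2 * n) / (2 * n + 1))
      (Real.arctan x / x) :=
    ((Real.hasSum_arctan hx).div_const x).congr_fun fun n => by
      push_cast
      rw [pow_succ]
      field_simp
  exact hsum.tsum_eq ▸ hasDerivAt_oddDilog (by simp) hx

theorem artanh_eq_log_sub_log {x : ℝ} (hx : |x| < 1) :
    Real.artanh x = (Real.log (1 + x) - Real.log (1 - x)) / 2 := by
  obtain ⟨h₁, h₂⟩ := abs_lt.1 hx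
  rw [Real.artanh_eq_half_log ⟨h₁.le, h₂.le⟩, Real.log_div (by linarith) (by linarith)]
  ring

theorem hasDerivAt_oddDilog_one {x : ℝ} (hx₀ : x ≠ 0) (hx : |x| < 1) :
    HasDerivAt (oddDilog 1) (Real.artanh x / x) x := by
  have hsum : HasSum (fun n : ℕ => (1 : ℝ) ^ n * x ^ (2 * n) / (2 * n + 1))
      (Real.artanh x / x) := by
    rw [artanh_eq_log_sub_log hx, div_div]
    refine ((Real.hasSum_log_sub_log_of_abs_lt_one hx).div_const (2 * x)).congr_fun fun n => ?_
    rw [pow_succ]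
    field_simp
    simp
  exact hsum.tsum_eq ▸ hasDerivAt_oddDilog (by simp) hx

theorem hasDerivAt_artanh {x : ℝ} (hx : |x| < 1) : HasDerivAt Real.artanh (1 / (1 - x ^ 2)) x := by
  obtain ⟨h₁, h₂⟩ := abs_lt.1 hx
  have hadd : 1 + x ≠ 0 := by linarith
  have hsub : 1 - x ≠ 0 := by linarith
  have h := ((((hasDerivAt_id x).const_add 1).log hadd).sub
    (((hasDerivAt_id x).const_sub 1).log hsub)).div_const 2
  refine (h.congr_of_eventuallyEq ?_).congr_deriv ?_
  · filter_upwards [isOpen_Ioo.mem_nhds (abs_lt.1 hx)] with y hy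
    exact artanh_eq_log_sub_log (abs_lt.2 hy)
  · rw [show 1 - x ^ 2 = (1 + x) * (1 - x) by ring]
    simp only [id]
    field_simp
    ring

theorem artanh_one_sub_div_one_add {x : ℝ} (hx : 0 < x) :
    Real.artanh ((1 - x) / (1 + x)) = -Real.log x / 2 := by
  have hadd : 1 + (1 - x) / (1 + x) = 2 / (1 + x) := by
    field_simp
    ring
  have hsub : 1 - (1 - x) / (1 + x) = 2 * x / (1 + x) := by
    field_simp
    ring
  have h : (1 + (1 - x) / (1 + x)) / (1 - (1 - x) / (1 + x)) = x⁻¹ := by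
    rw [hadd, hsub]
    field_simp
  rw [Real.artanh, h, Real.log_sqrt (by positivity), Real.log_inv]

theorem abs_one_sub_div_one_add_lt_one {x : ℝ} (hx : 0 < x) : |(1 - x) / (1 + x)| < 1 := by
  rw [abs_lt, lt_div_iff₀ (by positivity), div_lt_one (by positivity)]
  constructor <;> linarith

theorem hasDerivAt_oddDilog_one_add_sub {x : ℝ} (hx₀ : 0 < x) (hx₁ : x < 1) :
    HasDerivAt (fun y => oddDilog 1 y + oddDilog 1 ((1 - y) / (1 + y))
      - Real.log y * Real.artanh y) 0 x := by
  have hx : |x| < 1 := abs_lt.2 ⟨by linarith, hx₁⟩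
  have hsub : 0 < 1 - x := by linarith
  have hadd : 1 + x ≠ 0 := by linarith
  have hinv : HasDerivAt (fun y : ℝ => (1 - y) / (1 + y)) (-2 / (1 + x) ^ 2) x := by
    refine (((hasDerivAt_id x).const_sub 1).div ((hasDerivAt_id x).const_add 1) hadd).congr_deriv ?_
    simp only [id]
    ring
  have hcomp := (hasDerivAt_oddDilog_one (by positivity) (abs_one_sub_div_one_add_lt_one hx₀)).comp
    x hinv
  refine (((hasDerivAt_oddDilog_one hx₀.ne' hx).add hcomp).sub
    ((Real.hasDerivAt_log hx₀.ne').mul (hasDerivAt_artanh hx))).congr_deriv ?_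
  rw [artanh_one_sub_div_one_add hx₀, show 1 - x ^ 2 = (1 + x) * (1 - x) by ring]
  field_simp
  ring

theorem continuousOn_log_mul_artanh :
    ContinuousOn (fun x => Real.log x * Real.artanh x) (Ioo (-1) 1) := by
  have hartanh : ContinuousOn Real.artanh (Ioo (-1) 1) := fun x hx =>
    (hasDerivAt_artanh (abs_lt.2 hx)).continuousAt.continuousWithinAt
  have hslope : ContinuousOn (dslope Real.artanh 0) (Ioo (-1) 1) :=
    (continuousOn_dslope (Ioo_mem_nhds (by norm_num) one_pos)).2
      ⟨hartanh, (hasDerivAt_artanh (by norm_num)).differentiableAt⟩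
  refine (Real.continuous_mul_log.continuousOn.mul hslope).congr fun x _ => ?_
  have h := sub_smul_dslope Real.artanh 0 x
  rw [sub_zero, Real.artanh_zero, sub_zero, smul_eq_mul] at h
  rw [← h, Pi.mul_apply]
  ring

/-- Legendre's reflection formula for `χ₂`. -/
theorem oddDilog_one_add_oddDilog_one {x : ℝ} (hx₀ : 0 < x) (hx₁ : x < 1) :
    oddDilog 1 x + oddDilog 1 ((1 - x) / (1 + x))
      = Real.pi ^ 2 / 8 + Real.log x * Real.artanh x := by
  have hcont : ContinuousOn (fun y => oddDilog 1 y + oddDilog 1 ((1 - y) / (1 + y))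
      - Real.log y * Real.artanh y) (Icc 0 x) := by
    have hχ := continuousOn_oddDilog (ε := 1) (by simp)
    refine ((hχ.mono (Icc_subset_Icc (by norm_num) hx₁.le)).add (hχ.comp ?_ fun y hy => ?_)).sub
      (continuousOn_log_mul_artanh.mono (Icc_subset_Ioo (by norm_num) hx₁))
    · exact ContinuousOn.div (by fun_prop) (by fun_prop) fun y hy => by linarith [hy.1]
    · obtain ⟨hy₀, -⟩ := hy
      refine ⟨?_, ?_⟩
      · rw [le_div_iff₀ (by positivity)]
        linarith
      · rw [div_le_one (by positivity)]
        linarith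
  obtain ⟨c, -, hc⟩ := exists_hasDerivAt_eq_slope _ 0 hx₀ hcont fun y hy =>
    hasDerivAt_oddDilog_one_add_sub hy.1 (hy.2.trans hx₁)
  have h := (div_eq_zero_iff.1 hc.symm).resolve_right (by linarith)
  simp only [oddDilog_zero, sub_zero, add_zero, div_one, oddDilog_one_one, Real.log_zero, zero_mul,
    zero_add] at h
  linarith

theorem arsinh_eq_two_mul_artanh (p : ℝ) :
    Real.arsinh p = 2 * Real.artanh (p / (1 + √(1 + p ^ 2))) := by
  have hr : |p| < √(1 + p ^ 2) := Real.lt_sqrt_of_sq_lt (by rw [sq_abs]; linarith)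
  have hrr : √(1 + p ^ 2) ^ 2 = 1 + p ^ 2 := Real.sq_sqrt (by positivity)
  obtain ⟨h₁, h₂⟩ := abs_lt.1 hr
  rw [Real.arsinh]
  set r := √(1 + p ^ 2)
  have hr₀ : 0 < 1 + r := by positivity
  have hsub : 1 + r - p ≠ 0 := by linarith
  have hexp : (1 + p / (1 + r)) / (1 - p / (1 + r)) = p + r := by
    rw [div_eq_iff (by rw [sub_ne_zero, ne_eq, eq_div_iff hr₀.ne']; contrapose! hsub; linarith)]
    field_simp
    linear_combination -hrr
  rw [Real.artanh, hexp, Real.log_sqrt (by linarith)]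
  ring

theorem oddDilog_one_one_div_one_add_sqrt_two :
    oddDilog 1 (1 / (1 + √2)) = Real.pi ^ 2 / 16 - Real.arsinh 1 ^ 2 / 4 := by
  have h2 : √2 ^ 2 = 2 := Real.sq_sqrt (by norm_num)
  have hreflection := oddDilog_one_add_oddDilog_one (x := 1 / (1 + √2)) (by positivity)
    (by rw [div_lt_one (by positivity)]; linarith [Real.sqrt_pos.2 (two_pos (α := ℝ))])
  have hfixed : (1 - 1 / (1 + √2)) / (1 + 1 / (1 + √2)) = 1 / (1 + √2) := by
    field_simp
    linear_combination h2
  have hartanh := arsinh_eq_two_mul_artanh 1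
  have hlog : Real.log (1 / (1 + √2)) = -Real.arsinh 1 := by
    rw [one_div, Real.log_inv, Real.arsinh, one_pow, one_add_one_eq_two]
  rw [one_pow, one_add_one_eq_two] at hartanh
  rw [hfixed, hlog] at hreflection
  rw [show Real.artanh (1 / (1 + √2)) = Real.arsinh 1 / 2 by linarith] at hreflection
  linarith

end OddDilog

/-! ### The wave action of the kernel -/

section KernelIntegral

theorem integral_Ioc_eq_sub_of_hasDerivAt_of_nonneg {a b : ℝ} {g g' : ℝ → ℝ} (hab : a ≤ b)
    (hcont : ContinuousOn g (Icc a b)) (hderiv : ∀ x ∈ Ioo a b, HasDerivAt g (g' x) x)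
    (hnonneg : ∀ x ∈ Ioo a b, 0 ≤ g' x) : ∫ x in Ioc a b, g' x = g b - g a := by
  have hint := intervalIntegral.integrableOn_deriv_of_nonneg hcont hderiv hnonneg
  rw [← intervalIntegral.integral_of_le hab,
    intervalIntegral.integral_eq_sub_of_hasDerivAt_of_le hab hcont hderiv
      ((intervalIntegrable_iff_integrableOn_Ioc_of_le hab).2 hint)]

theorem div_one_add_sqrt_mem_Icc {p : ℝ} (hp : p ∈ Icc (0 : ℝ) 1) (q : ℝ) :
    p / (1 + √q) ∈ Icc (-1 : ℝ) 1 := by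
  have hq : 0 ≤ √q := Real.sqrt_nonneg q
  refine ⟨by linarith [div_nonneg hp.1 (by positivity : 0 ≤ 1 + √q)], ?_⟩
  rw [div_le_one (by positivity)]
  linarith [hp.2]

theorem hasDerivAt_div_one_add_sqrt {c p : ℝ} (h : 0 < 1 + c * p ^ 2) :
    HasDerivAt (fun x : ℝ => x / (1 + √(1 + c * x ^ 2)))
      (1 / (√(1 + c * p ^ 2) * (1 + √(1 + c * p ^ 2)))) p := by
  have hs : 0 < √(1 + c * p ^ 2) := Real.sqrt_pos.2 h
  have hss : √(1 + c * p ^ 2) ^ 2 = 1 + c * p ^ 2 := Real.sq_sqrt h.le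
  have hdenom := ((((hasDerivAt_pow 2 p).const_mul c).const_add 1).sqrt h.ne').const_add 1
  refine ((hasDerivAt_id p).div hdenom (by positivity)).congr_deriv ?_
  simp only [id]
  set s := √(1 + c * p ^ 2)
  field_simp
  push_cast
  linear_combination 2 * hss

/-- A primitive on `(0, 1)` of `(1 + p) * arcPart p`. -/
noncomputable def arcPrimitive (p : ℝ) : ℝ :=
  Real.arcsin p ^ 2 - Real.arsinh p ^ 2
    + 4 * oddDilog (-1) (p / (1 + √(1 - p ^ 2))) - 4 * oddDilog 1 (p / (1 + √(1 + p ^ 2)))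

theorem continuousOn_arcPrimitive : ContinuousOn arcPrimitive (Icc 0 1) := by
  have hcont {ε : ℝ} {q : ℝ → ℝ} (hε : |ε| ≤ 1) (hq : Continuous q) :
      ContinuousOn (fun p => oddDilog ε (p / (1 + √(q p)))) (Icc 0 1) :=
    (continuousOn_oddDilog hε).comp
      (continuous_id.div (by fun_prop) fun p => by positivity).continuousOn
      fun p hp => div_one_add_sqrt_mem_Icc hp (q p)
  have hsq : Continuous fun p => Real.arcsin p ^ 2 - Real.arsinh p ^ 2 :=
    (Real.continuous_arcsin.pow 2).sub (Real.continuous_arsinh.pow 2)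
  exact (hsq.continuousOn.add ((hcont (by simp) (by fun_prop)).const_mul 4)).sub
    ((hcont (by simp) (by fun_prop)).const_mul 4)

theorem hasDerivAt_oddDilog_neg_one_comp {p : ℝ} (h₀ : 0 < p) (h₁ : p < 1) :
    HasDerivAt (fun p => oddDilog (-1) (p / (1 + √(1 - p ^ 2))))
      (Real.arcsin p / (2 * p * √(1 - p ^ 2))) p := by
  have hs : 0 < √(1 - p ^ 2) := Real.sqrt_pos.2 (by nlinarith)
  have hinner := hasDerivAt_div_one_add_sqrt (c := -1) (p := p) (by nlinarith)
  simp only [neg_one_mul, ← sub_eq_add_neg] at hinner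
  have houter := hasDerivAt_oddDilog_neg_one (x := p / (1 + √(1 - p ^ 2))) (by positivity)
    (by rw [abs_of_pos (by positivity), div_lt_one (by positivity)]; linarith)
  refine (houter.comp p hinner).congr_deriv ?_
  rw [arcsin_eq_two_mul_arctan (by linarith) h₁]
  field_simp

theorem hasDerivAt_oddDilog_one_comp {p : ℝ} (h₀ : 0 < p) :
    HasDerivAt (fun p => oddDilog 1 (p / (1 + √(1 + p ^ 2))))
      (Real.arsinh p / (2 * p * √(1 + p ^ 2))) p := by
  have hr : p < √(1 + p ^ 2) := Real.lt_sqrt_of_sq_lt (by linarith)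
  have hinner := hasDerivAt_div_one_add_sqrt (c := 1) (p := p) (by positivity)
  simp only [one_mul] at hinner
  have houter := hasDerivAt_oddDilog_one (x := p / (1 + √(1 + p ^ 2))) (by positivity)
    (by rw [abs_of_pos (by positivity), div_lt_one (by positivity)]; linarith)
  refine (houter.comp p hinner).congr_deriv ?_
  rw [arsinh_eq_two_mul_artanh]
  field_simp

theorem hasDerivAt_arcPrimitive {p : ℝ} (h₀ : 0 < p) (h₁ : p < 1) :
    HasDerivAt arcPrimitive ((1 + p) * arcPart p) p := by
  have hs : 0 < √(1 - p ^ 2) := Real.sqrt_pos.2 (by nlinarith)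
  have harcsin := (Real.hasDerivAt_arcsin (by linarith : p ≠ -1) h₁.ne).pow 2
  have harsinh := (Real.hasDerivAt_arsinh p).pow 2
  refine (((harcsin.sub harsinh).add ((hasDerivAt_oddDilog_neg_one_comp h₀ h₁).const_mul 4)).sub
    ((hasDerivAt_oddDilog_one_comp h₀).const_mul 4)).congr_deriv ?_
  rw [arcPart]
  field_simp
  ring

theorem one_add_mul_arcPart_nonneg {p : ℝ} (hp : p ∈ Ioo (0 : ℝ) 1) : 0 ≤ (1 + p) * arcPart p :=
  mul_nonneg (by linarith [hp.1]) (arcPart_nonneg hp.1 hp.2)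

theorem integrableOn_one_add_mul_arcPart :
    IntegrableOn (fun p => (1 + p) * arcPart p) (Ioc 0 1) :=
  intervalIntegral.integrableOn_deriv_of_nonneg continuousOn_arcPrimitive
    (fun _ hp => hasDerivAt_arcPrimitive hp.1 hp.2) fun _ => one_add_mul_arcPart_nonneg

theorem integral_one_add_mul_arcPart : ∫ p in Ioc 0 1, (1 + p) * arcPart p = 4 * catalanG := by
  rw [integral_Ioc_eq_sub_of_hasDerivAt_of_nonneg zero_le_one continuousOn_arcPrimitive
    (fun _ hp => hasDerivAt_arcPrimitive hp.1 hp.2) fun _ => one_add_mul_arcPart_nonneg]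
  simp only [arcPrimitive, Real.arcsin_one, Real.arcsin_zero, Real.arsinh_zero, zero_div,
    oddDilog_zero, one_pow, sub_self, Real.sqrt_zero, add_zero, div_one, oddDilog_neg_one_one,
    one_add_one_eq_two, oddDilog_one_one_div_one_add_sqrt_two]
  ring

/-- A primitive on `(0, 1)` of `-log p * p ^ k`, continuous up to `0`. -/
noncomputable def logPowPrimitive (k : ℕ) (p : ℝ) : ℝ :=
  p ^ (k + 1) / ((k : ℝ) + 1) ^ 2 - p ^ (k + 1) * Real.log p / ((k : ℝ) + 1)

theorem continuous_logPowPrimitive (k : ℕ) : Continuous (logPowPrimitive k) := by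
  have := Real.continuous_mul_log
  unfold logPowPrimitive
  simp only [pow_succ, mul_assoc]
  fun_prop

theorem hasDerivAt_logPowPrimitive (k : ℕ) {p : ℝ} (hp : 0 < p) :
    HasDerivAt (logPowPrimitive k) (-Real.log p * p ^ k) p := by
  have hpow := (hasDerivAt_pow (k + 1) p).div_const (((k : ℝ) + 1) ^ 2)
  have hlog := ((hasDerivAt_pow (k + 1) p).mul (Real.hasDerivAt_log hp.ne')).div_const
    ((k : ℝ) + 1)
  refine (hpow.sub hlog).congr_deriv ?_
  push_cast
  field_simp
  ring

theorem neg_log_mul_pow_nonneg (k : ℕ) {p : ℝ} (hp : p ∈ Ioo (0 : ℝ) 1) :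
    0 ≤ -Real.log p * p ^ k :=
  mul_nonneg (neg_nonneg.2 (Real.log_nonpos hp.1.le hp.2.le)) (pow_nonneg hp.1.le k)

theorem integrableOn_neg_log_mul_pow (k : ℕ) :
    IntegrableOn (fun p : ℝ => -Real.log p * p ^ k) (Ioc 0 1) :=
  intervalIntegral.integrableOn_deriv_of_nonneg (continuous_logPowPrimitive k).continuousOn
    (fun _ hp => hasDerivAt_logPowPrimitive k hp.1) fun _ => neg_log_mul_pow_nonneg k

theorem integral_neg_log_mul_pow (k : ℕ) :
    ∫ p in Ioc (0 : ℝ) 1, -Real.log p * p ^ k = 1 / ((k : ℝ) + 1) ^ 2 := by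
  rw [integral_Ioc_eq_sub_of_hasDerivAt_of_nonneg zero_le_one
    (continuous_logPowPrimitive k).continuousOn
    (fun _ hp => hasDerivAt_logPowPrimitive k hp.1) fun _ => neg_log_mul_pow_nonneg k]
  simp [logPowPrimitive]

theorem hasSum_one_div_four_mul_add_four_sq :
    HasSum (fun n : ℕ => 1 / (4 * (n : ℝ) + 4) ^ 2) (Real.pi ^ 2 / 96) := by
  have h := ((hasSum_nat_add_iff' 1).2 hasSum_zeta_two).div_const 16
  simp only [Finset.range_one, Finset.sum_singleton, Nat.cast_zero, ne_eq, OfNat.ofNat_ne_zero,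
    not_false_eq_true, zero_pow, div_zero, sub_zero] at h
  rw [show Real.pi ^ 2 / 96 = Real.pi ^ 2 / 6 / 16 by ring]
  refine h.congr_fun fun n => ?_
  push_cast
  rw [show 4 * (n : ℝ) + 4 = 4 * (n + 1) by ring, mul_pow, div_div, mul_comm]
  norm_num

theorem hasSum_one_div_four_mul_add_three_sq :
    HasSum (fun n : ℕ => 1 / (4 * (n : ℝ) + 3) ^ 2) (Real.pi ^ 2 / 16 - catalanG / 2) := by
  have hsummable (j : ℕ) : Summable fun n : ℕ => 1 / (4 * (n : ℝ) + j) ^ 2 :=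
    (hasSum_zeta_two.summable.comp_injective (i := fun n : ℕ => 4 * n + j)
      fun a b h => by simpa using h).congr fun n => by simp
  obtain ⟨a, ha⟩ := hsummable 1
  obtain ⟨b, hb⟩ := hsummable 3
  have hodd : ∑' n : ℕ, 1 / (2 * (n : ℝ) + 1) ^ 2 = a + b :=
    (HasSum.even_add_odd (f := fun n : ℕ => 1 / (2 * (n : ℝ) + 1) ^ 2)
      (ha.congr_fun fun n => by push_cast; ring_nf)
      (hb.congr_fun fun n => by push_cast; ring_nf)).tsum_eq
  have hcatalan : catalanG = a + -b :=
    (HasSum.even_add_odd (f := fun n : ℕ => (-1 : ℝ) ^ n / (2 * (n : ℝ) + 1) ^ 2)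
      (ha.congr_fun fun n => by rw [pow_mul]; push_cast; ring_nf)
      (hb.neg.congr_fun fun n => by rw [pow_succ, pow_mul]; push_cast; ring_nf)).tsum_eq
  rw [tsum_one_div_odd_sq] at hodd
  rw [show Real.pi ^ 2 / 16 - catalanG / 2 = b by linarith]
  exact_mod_cast hb

/-- The `n`-th term of the expansion of `(1 + p) * logPart p` on `(0, 1)` obtained from the
geometric series of `1 / (1 - p ^ 4)`. -/
noncomputable def logPartTerm (n : ℕ) (p : ℝ) : ℝ :=
  4 * (-Real.log p * p ^ (4 * n + 2) + -Real.log p * p ^ (4 * n + 3))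

theorem hasSum_logPartTerm {p : ℝ} (hp : p ∈ Ioo (0 : ℝ) 1) :
    HasSum (fun n => logPartTerm n p) ((1 + p) * logPart p) := by
  have h4 : p ^ 4 < 1 := pow_lt_one₀ hp.1.le hp.2 (by norm_num)
  have h := (hasSum_geometric_of_lt_one (pow_nonneg hp.1.le 4) h4).mul_left
    (4 * (-Real.log p * (p ^ 2 + p ^ 3)))
  rw [show (1 + p) * logPart p = 4 * (-Real.log p * (p ^ 2 + p ^ 3)) * (1 - p ^ 4)⁻¹ by
    rw [logPart]; ring]
  refine h.congr_fun fun n => ?_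
  rw [logPartTerm, pow_add, pow_add, pow_mul]
  ring

theorem integrableOn_logPartTerm (n : ℕ) : IntegrableOn (logPartTerm n) (Ioc 0 1) :=
  ((integrableOn_neg_log_mul_pow _).add (integrableOn_neg_log_mul_pow _)).const_mul 4

theorem integral_logPartTerm (n : ℕ) : ∫ p in Ioc 0 1, logPartTerm n p
    = 4 * (1 / (4 * (n : ℝ) + 3) ^ 2 + 1 / (4 * (n : ℝ) + 4) ^ 2) := by
  simp only [logPartTerm]
  rw [integral_const_mul, integral_add (integrableOn_neg_log_mul_pow _)
    (integrableOn_neg_log_mul_pow _), integral_neg_log_mul_pow, integral_neg_log_mul_pow]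
  push_cast
  ring_nf

theorem integral_norm_logPartTerm (n : ℕ) :
    ∫ p in Ioc 0 1, ‖logPartTerm n p‖ = ∫ p in Ioc 0 1, logPartTerm n p := by
  rw [integral_Ioc_eq_integral_Ioo, integral_Ioc_eq_integral_Ioo]
  refine setIntegral_congr_fun measurableSet_Ioo fun p hp => Real.norm_of_nonneg ?_
  exact mul_nonneg (by norm_num)
    (add_nonneg (neg_log_mul_pow_nonneg _ hp) (neg_log_mul_pow_nonneg _ hp))

theorem integral_one_add_mul_logPart :
    ∫ p in Ioo 0 1, (1 + p) * logPart p = 7 * Real.pi ^ 2 / 24 - 2 * catalanG := by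
  have hsum := (hasSum_one_div_four_mul_add_three_sq.add
    hasSum_one_div_four_mul_add_four_sq).mul_left 4
  have h := hasSum_integral_of_summable_integral_norm integrableOn_logPartTerm
    (by simpa only [integral_norm_logPartTerm, integral_logPartTerm] using hsum.summable)
  simp only [integral_logPartTerm] at h
  calc ∫ p in Ioo 0 1, (1 + p) * logPart p
      = ∫ p in Ioo 0 1, ∑' n, logPartTerm n p :=
        setIntegral_congr_fun measurableSet_Ioo fun p hp => (hasSum_logPartTerm hp).tsum_eq.symm
    _ = 4 * (Real.pi ^ 2 / 16 - catalanG / 2 + Real.pi ^ 2 / 96) := by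
        rw [← integral_Ioc_eq_integral_Ioo, h.unique hsum]
    _ = 7 * Real.pi ^ 2 / 24 - 2 * catalanG := by ring

theorem one_add_mul_logPart_le {p : ℝ} (hp : p ∈ Ioo (0 : ℝ) 1) : (1 + p) * logPart p ≤ 4 := by
  obtain ⟨h₀, h₁⟩ := hp
  have h2 : 0 < 1 - p ^ 2 := by nlinarith
  have h4 : 0 < 1 - p ^ 4 := sub_pos.2 (pow_lt_one₀ h₀.le h₁ (by norm_num))
  have hlog : -Real.log p ≤ p⁻¹ - 1 := by linarith [Real.one_sub_inv_le_log_of_pos h₀]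
  rw [logPart, ← mul_neg, mul_div_assoc', div_le_iff₀ h4]
  calc (1 + p) * (4 * p ^ 2 * -Real.log p) ≤ (1 + p) * (4 * p ^ 2 * (p⁻¹ - 1)) := by gcongr
    _ = 4 * (p * (1 - p ^ 2)) := by
        field_simp
        ring
    _ ≤ 4 * (1 - p ^ 4) := by nlinarith [mul_pos h2 (by nlinarith : 0 < 1 + p ^ 2 - p)]

theorem integrableOn_one_add_mul_logPart :
    IntegrableOn (fun p => (1 + p) * logPart p) (Ioo 0 1) := by
  refine Measure.integrableOn_of_bounded (M := 4) (by simp) ?_ ?_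
  · unfold logPart
    exact Measurable.aestronglyMeasurable (by fun_prop)
  · refine ae_restrict_of_forall_mem measurableSet_Ioo fun p hp => ?_
    rw [Real.norm_of_nonneg (mul_nonneg (by linarith [hp.1]) (logPart_pos hp.1 hp.2).le)]
    exact one_add_mul_logPart_le hp

theorem integral_one_add_mul_kernelV :
    ∫ p in Ioo 0 1, (1 + p) * kernelV p = 7 * Real.pi ^ 2 / 24 + 2 * catalanG := by
  have harc := integral_one_add_mul_arcPart
  rw [integral_Ioc_eq_integral_Ioo] at harc
  calc ∫ p in Ioo 0 1, (1 + p) * kernelV p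
      = ∫ p in Ioo 0 1, ((1 + p) * logPart p + (1 + p) * arcPart p) :=
        setIntegral_congr_fun measurableSet_Ioo fun p hp => by
          simp only [kernelV_of_lt_one hp.1 hp.2, mul_add]
    _ = 7 * Real.pi ^ 2 / 24 - 2 * catalanG + 4 * catalanG := by
        rw [integral_add integrableOn_one_add_mul_logPart
          (integrableOn_one_add_mul_arcPart.mono_set Ioo_subset_Ioc_self),
          integral_one_add_mul_logPart, harc]
    _ = 7 * Real.pi ^ 2 / 24 + 2 * catalanG := by ring

theorem image_exp_half_Iio_zero : (fun x : ℝ => Real.exp (x / 2)) '' Iio 0 = Ioo 0 1 := by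
  ext p
  constructor
  · rintro ⟨x, hx, rfl⟩
    exact ⟨Real.exp_pos _, Real.exp_lt_one_iff.2 (div_neg_of_neg_of_pos hx two_pos)⟩
  · rintro ⟨h₀, h₁⟩
    exact ⟨2 * Real.log p, mul_neg_of_pos_of_neg two_pos (Real.log_neg h₀ h₁), by
      simp [Real.exp_log h₀]⟩

theorem integral_Iio_K_mul_exp_half_add_exp :
    ∫ x in Iio 0, (K x * Real.exp (1 / 2 * x) + K x * Real.exp (1 * x)) = -gamma := by
  have hinj : InjOn (fun x : ℝ => Real.exp (x / 2)) (Iio 0) := fun x _ y _ hxy => by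
    linarith [Real.exp_injective hxy]
  have hsubst := integral_image_eq_integral_abs_deriv_smul measurableSet_Iio
    (fun x _ => ((hasDerivAt_id x).div_const 2).exp.hasDerivWithinAt) hinj
    fun p => (1 + p) * kernelV p
  simp only [id] at hsubst
  rw [image_exp_half_Iio_zero, integral_one_add_mul_kernelV] at hsubst
  rw [gamma, gammaN, show -(2 * -(2 * catalanG + 7 * Real.pi ^ 2 / 24))
    = 2 * (7 * Real.pi ^ 2 / 24 + 2 * catalanG) by ring, hsubst, ← integral_const_mul]
  refine setIntegral_congr_fun measurableSet_Iio fun x _ => ?_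
  simp only [smul_eq_mul, K]
  rw [abs_of_pos (by positivity), show 1 * x = x / 2 + x / 2 by ring, Real.exp_add,
    show 1 / 2 * x = x / 2 by ring]
  ring

theorem integral_K_mul_exp_half : ∫ x, K x * Real.exp (1 / 2 * x) = -gamma := by
  have hhalf := integrable_K_mul_exp (σ := 1 / 2) (by norm_num) (by norm_num)
  have hone := integrable_K_mul_exp (σ := 1) (by norm_num) (by norm_num)
  have hpos : ∫ x in Ioi 0, K x * Real.exp (1 / 2 * x)
      = ∫ x in Iio 0, K x * Real.exp (1 * x) := by
    rw [← integral_Iic_eq_integral_Iio]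
    have h := integral_comp_neg_Iic 0 fun x => K x * Real.exp (1 / 2 * x)
    rw [neg_zero] at h
    rw [← h]
    simp only [K_neg_mul_exp]
    norm_num
  rw [← intervalIntegral.integral_Iic_add_Ioi hhalf.integrableOn hhalf.integrableOn (b := 0), hpos,
    integral_Iic_eq_integral_Iio, ← integral_add hhalf.integrableOn hone.integrableOn,
    integral_Iio_K_mul_exp_half_add_exp]

theorem integral_K_mul_exp_one : ∫ x, K x * Real.exp (1 * x) = -gamma := by
  rw [← integral_K_mul_exp_half, ← integral_K_mul_exp_three_halves_sub (1 / 2)]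
  norm_num

theorem gamma_add_integral_K_mul_exp_neg {s : ℝ} (h₁ : 1 / 2 < s) (h₂ : s < 1) :
    gamma + ∫ x, K x * Real.exp (s * x) < 0 := by
  have h := strictConvexOn_integral_K_mul_exp.lt_on_openSegment (x := 1 / 2) (y := 1) (z := s)
    (by norm_num) (by norm_num) (by norm_num)
    (by rw [openSegment_eq_Ioo (by norm_num)]; exact ⟨h₁, h₂⟩)
  simp only [integral_K_mul_exp_half, integral_K_mul_exp_one, max_self] at h
  linarith

end KernelIntegral

/-! ### The contour formula -/

section ContourFormula

theorem hat_ofReal_mul_I (g : ℝ → ℝ) (σ : ℝ) :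
    hat g (σ * Complex.I) = ((∫ x, g x * Real.exp (σ * x) : ℝ) : ℂ) := by
  rw [hat, ← integral_complex_ofReal]
  refine integral_congr_ae (Filter.Eventually.of_forall fun x => ?_)
  simp only
  rw [show -(Complex.I * x * (σ * Complex.I)) = σ * x by linear_combination -(σ * x) * Complex.I_sq]
  push_cast
  ring

theorem Omega_half_mul_I : Omega ((1 / 2 : ℝ) * Complex.I) = 0 := by
  rw [Omega, hat_ofReal_mul_I, integral_K_mul_exp_half]
  simp

theorem abs_setIntegral_Ioi_mul_exp_le {g : ℝ → ℝ} {a s : ℝ} (has : a ≤ s) (L : ℝ)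
    (hg : Integrable fun x => g x * Real.exp (s * x)) :
    |∫ x in Ioi L, g x * Real.exp (a * x)|
      ≤ Real.exp ((a - s) * L) * ∫ x, |g x| * Real.exp (s * x) := by
  have habs : Integrable fun x => |g x| * Real.exp (s * x) :=
    hg.norm.congr (Filter.Eventually.of_forall fun x => by simp)
  calc |∫ x in Ioi L, g x * Real.exp (a * x)|
      ≤ ∫ x in Ioi L, Real.exp ((a - s) * L) * (|g x| * Real.exp (s * x)) := by
        rw [← Real.norm_eq_abs]
        refine norm_integral_le_of_norm_le (habs.const_mul _).integrableOn
          (ae_restrict_of_forall_mem measurableSet_Ioi fun x hx => ?_)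
        rw [norm_mul, Real.norm_eq_abs, Real.norm_of_nonneg (Real.exp_pos _).le, mul_left_comm,
          ← Real.exp_add]
        gcongr
        nlinarith [mem_Ioi.1 hx]
    _ ≤ ∫ x, Real.exp ((a - s) * L) * (|g x| * Real.exp (s * x)) :=
        setIntegral_le_integral (habs.const_mul _)
          (Filter.Eventually.of_forall fun x => by positivity)
    _ = _ := integral_const_mul _ _

variable {p : ℝ≥0∞} [Fact (1 ≤ p)] {f₀ : ℝ → ℝ} {f : ℝ → Lp ℝ p (volume : Measure ℝ)} {σ t : ℝ}

theorem IsSolution.integrable_mul_exp (h : IsSolution p f₀ f) (hσ₁ : -1 < σ) (hσ₂ : σ < 5 / 2)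
    (h₀ : Integrable fun x => f₀ x * Real.exp (σ * x)) (ht : 0 ≤ t) :
    Integrable fun x => f t x * Real.exp (σ * x) :=
  memLp_one_iff_integrable.1 (h.memLp_weighted integrable_K (integrable_K_mul_exp hσ₁ hσ₂)
    (memLp_one_iff_integrable.2 h₀) ht)

theorem IsSolution.integral_mul_exp_half_eq (h : IsSolution p f₀ f)
    (h₀ : Integrable fun x => f₀ x * Real.exp (1 / 2 * x)) (ht : 0 ≤ t) :
    ∫ x, f t x * Real.exp (1 / 2 * x) = ∫ x, f₀ x * Real.exp (1 / 2 * x) := by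
  have e := h.hat_eq integrable_K (integrable_K_mul_exp (by norm_num) (by norm_num)) h₀ ht 0
  rw [Complex.ofReal_zero, zero_add, Omega_half_mul_I, hat_ofReal_mul_I, hat_ofReal_mul_I,
    zero_mul, Complex.exp_zero, one_mul] at e
  exact_mod_cast e

theorem IsSolution.contourIntegrand_eq (h : IsSolution p f₀ f) (hσ₁ : -1 < σ) (hσ₂ : σ < 5 / 2)
    (h₁ : Integrable fun x => f₀ x * Real.exp (σ * x)) (ht : 0 ≤ t) (L u : ℝ) :
    contourIntegrand f₀ t L (u + σ * Complex.I)
      = hat (f t) (u + σ * Complex.I) * contourWeight (1 / 2) L (u + σ * Complex.I) := by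
  rw [h.hat_eq integrable_K (integrable_K_mul_exp hσ₁ hσ₂) h₁ ht u, contourIntegrand,
    contourWeight]
  push_cast
  ring

theorem IsSolution.integrable_contourIntegrand (h : IsSolution p f₀ f) (hσ₁ : 1 / 2 < σ)
    (hσ₂ : σ < 5 / 2) (h₁ : Integrable fun x => f₀ x * Real.exp (σ * x))
    (h₂ : MemLp (fun x => f₀ x * Real.exp (σ * x)) 2) (ht : 0 ≤ t) (L : ℝ) :
    Integrable fun u : ℝ => contourIntegrand f₀ t L (u + σ * Complex.I) := by
  have hσ : -1 < σ := by linarith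
  simp only [h.contourIntegrand_eq hσ hσ₂ h₁ ht L]
  exact integrable_hat_mul_contourWeight hσ₁ L (h.integrable_mul_exp hσ hσ₂ h₁ ht)
    (h.memLp_weighted integrable_K (integrable_K_mul_exp hσ hσ₂) h₂ ht)

theorem IsSolution.integral_contourIntegrand (h : IsSolution p f₀ f) (hσ₁ : 1 / 2 < σ)
    (hσ₂ : σ < 5 / 2) (h₁ : Integrable fun x => f₀ x * Real.exp (σ * x))
    (h₂ : MemLp (fun x => f₀ x * Real.exp (σ * x)) 2) (ht : 0 ≤ t) (L : ℝ) :
    ∫ u : ℝ, contourIntegrand f₀ t L (u + σ * Complex.I)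
      = -(2 * Real.pi * ((∫ x in Ioi L, f t x * Real.exp (1 / 2 * x) : ℝ) : ℂ)) := by
  have hσ : -1 < σ := by linarith
  simp only [h.contourIntegrand_eq hσ hσ₂ h₁ ht L]
  exact integral_hat_mul_contourWeight hσ₁ L (h.integrable_mul_exp hσ hσ₂ h₁ ht)
    (h.memLp_weighted integrable_K (integrable_K_mul_exp hσ hσ₂) h₂ ht)

theorem IsSolution.integral_Iic_mul_exp_half_eq (h : IsSolution p f₀ f) (hσ₁ : 1 / 2 < σ)
    (hσ₂ : σ < 5 / 2) (h₀ : Integrable fun x => f₀ x * Real.exp (1 / 2 * x))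
    (h₁ : Integrable fun x => f₀ x * Real.exp (σ * x))
    (h₂ : MemLp (fun x => f₀ x * Real.exp (σ * x)) 2) (ht : 0 ≤ t) (L : ℝ) :
    ((∫ x in Iic L, f t x * Real.exp (1 / 2 * x) : ℝ) : ℂ)
      = ((∫ x, f t x * Real.exp (1 / 2 * x) : ℝ) : ℂ)
        + 1 / (2 * (Real.pi : ℂ)) * ∫ u : ℝ, contourIntegrand f₀ t L (u + σ * Complex.I) := by
  have hft := h.integrable_mul_exp (by norm_num) (by norm_num) h₀ ht
  have hpi : (Real.pi : ℂ) ≠ 0 := Complex.ofReal_ne_zero.2 Real.pi_ne_zero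
  rw [h.integral_contourIntegrand hσ₁ hσ₂ h₁ h₂ ht L,
    ← intervalIntegral.integral_Iic_add_Ioi hft.integrableOn hft.integrableOn (b := L)]
  push_cast
  field_simp
  ring

theorem IsSolution.integral_abs_mul_exp_le {s : ℝ} (h : IsSolution p f₀ f) (hs₁ : -1 < s)
    (hs₂ : s < 5 / 2) (h₀ : Integrable fun x => f₀ x * Real.exp (s * x)) (ht : 0 ≤ t) :
    ∫ x, |f t x| * Real.exp (s * x)
      ≤ Real.exp ((gamma + ∫ x, K x * Real.exp (s * x)) * t) * ∫ x, |f₀ x| * Real.exp (s * x) := by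
  simpa only [abs_of_nonneg (K_nonneg _)] using
    h.integral_abs_le integrable_K (integrable_K_mul_exp hs₁ hs₂) h₀ ht

theorem IsSolution.norm_integral_contourIntegrand_le {s : ℝ} (h : IsSolution p f₀ f)
    (hσ₁ : 1 / 2 < σ) (hσ₂ : σ < 5 / 2) (h₁ : Integrable fun x => f₀ x * Real.exp (σ * x))
    (h₂ : MemLp (fun x => f₀ x * Real.exp (σ * x)) 2) (hs₁ : 1 / 2 ≤ s) (hs₂ : s < 5 / 2)
    (h₀ : Integrable fun x => f₀ x * Real.exp (s * x)) (ht : 0 ≤ t) (L : ℝ) :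
    ‖∫ u : ℝ, contourIntegrand f₀ t L (u + σ * Complex.I)‖
      ≤ 2 * Real.pi * Real.exp ((1 / 2 - s) * L)
        * Real.exp ((gamma + ∫ x, K x * Real.exp (s * x)) * t)
        * ∫ x, |f₀ x| * Real.exp (s * x) := by
  have hs : -1 < s := by linarith
  have htail := abs_setIntegral_Ioi_mul_exp_le hs₁ L (h.integrable_mul_exp hs hs₂ h₀ ht)
  have hdecay := h.integral_abs_mul_exp_le hs hs₂ h₀ ht
  rw [h.integral_contourIntegrand hσ₁ hσ₂ h₁ h₂ ht L, norm_neg, norm_mul, norm_mul,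
    Complex.norm_real, Complex.norm_real, Complex.norm_ofNat, Real.norm_of_nonneg Real.pi_pos.le]
  calc 2 * Real.pi * |∫ x in Ioi L, f t x * Real.exp (1 / 2 * x)|
      ≤ 2 * Real.pi * (Real.exp ((1 / 2 - s) * L)
        * (Real.exp ((gamma + ∫ x, K x * Real.exp (s * x)) * t)
          * ∫ x, |f₀ x| * Real.exp (s * x))) := by
        gcongr
        exact htail.trans (mul_le_mul_of_nonneg_left hdecay (Real.exp_pos _).le)
    _ = _ := by ring

end ContourFormula

end RJ

theorem mainTheorem4_general {s : ℝ} (hs₁ : 1 / 2 < s) (hs₂ : s < 1) :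
    ∃ ν : ℝ, 0 < ν ∧
      Integrable (fun x : ℝ => RJ.K x * Real.exp (s * x)) ∧
      -(ν : ℂ) = (RJ.gamma : ℂ) + RJ.hat RJ.K (s * Complex.I) ∧
      ∀ L : ℝ, ∃ C : ℝ, 0 < C ∧
        ∀ (A B : ℝ), B < -s → 0 < A →
        ∀ f₀ : ℝ → ℝ, RJ.MemX A B f₀ →
        ∀ (p : ℝ≥0∞) [Fact (1 ≤ p)],
          (∃ f : ℝ → Lp ℝ p (volume : Measure ℝ), RJ.IsSolution p f₀ f) ∧
          ∀ f : ℝ → Lp ℝ p (volume : Measure ℝ), RJ.IsSolution p f₀ f →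
          ∀ σ : ℝ, 1 / 2 < σ → σ < -B → σ < 5 / 2 →
          ∀ t : ℝ, 0 ≤ t →
            Integrable (fun x : ℝ => f t x * Real.exp (1 / 2 * x)) ∧
            Integrable (fun x : ℝ => f₀ x * Real.exp (σ * x)) ∧
            Integrable (fun x : ℝ => RJ.K x * Real.exp (σ * x)) ∧
            Integrable (fun u : ℝ =>
              RJ.contourIntegrand f₀ t L ((u : ℂ) + (σ : ℂ) * Complex.I)) ∧
            Integrable (fun x : ℝ => |f₀ x| * Real.exp (s * x)) ∧
            (∫ x : ℝ, f t x * Real.exp (1 / 2 * x)) = ∫ x : ℝ, f₀ x * Real.exp (1 / 2 * x) ∧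
            ((∫ x in Iic L, f t x * Real.exp (1 / 2 * x) : ℝ) : ℂ) =
              ((∫ x : ℝ, f t x * Real.exp (1 / 2 * x) : ℝ) : ℂ) +
                1 / (2 * (Real.pi : ℂ)) *
                  ∫ u : ℝ, RJ.contourIntegrand f₀ t L ((u : ℂ) + (σ : ℂ) * Complex.I) ∧
            ‖∫ u : ℝ, RJ.contourIntegrand f₀ t L ((u : ℂ) + (σ : ℂ) * Complex.I)‖ ≤
              C * Real.exp (-ν * t) * ∫ x : ℝ, |f₀ x| * Real.exp (s * x) := by
  refine ⟨-(RJ.gamma + ∫ x, RJ.K x * Real.exp (s * x)),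
    neg_pos.2 (RJ.gamma_add_integral_K_mul_exp_neg hs₁ hs₂),
    RJ.integrable_K_mul_exp (by linarith) (by linarith),
    by rw [RJ.hat_ofReal_mul_I, Complex.ofReal_neg, Complex.ofReal_add, neg_neg],
    fun L => ⟨2 * Real.pi * Real.exp ((1 / 2 - s) * L), by positivity,
      fun A B hB hA f₀ hX p _ => ⟨RJ.exists_isSolution RJ.integrable_K ?_,
        fun f hf σ hσ₁ hσB hσ₂ t ht => ?_⟩⟩⟩
  · simpa using hX.memLp_weighted (σ := 0) (by linarith) (by linarith)
  have hint {r : ℝ} (hr : 0 < r) (hrB : r < -B) : Integrable fun x => f₀ x * Real.exp (r * x) :=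
    memLp_one_iff_integrable.1 (hX.memLp_weighted (by linarith) hrB)
  have h₀ := hint (r := 1 / 2) (by linarith) (by linarith)
  have h₁ := hint (r := σ) (by linarith) hσB
  have h₂ : MemLp (fun x => f₀ x * Real.exp (σ * x)) 2 := hX.memLp_weighted (by linarith) hσB
  have hs := hint (r := s) (by linarith) (by linarith)
  refine ⟨hf.integrable_mul_exp (by norm_num) (by norm_num) h₀ ht, h₁,
    RJ.integrable_K_mul_exp (by linarith) hσ₂, hf.integrable_contourIntegrand hσ₁ hσ₂ h₁ h₂ ht L,
    by simpa [abs_mul] using hs.abs, hf.integral_mul_exp_half_eq h₀ ht,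
    hf.integral_Iic_mul_exp_half_eq hσ₁ hσ₂ h₀ h₁ h₂ ht L, ?_⟩
  rw [neg_neg]
  exact hf.norm_integral_contourIntegrand_le hσ₁ hσ₂ h₁ h₂ hs₁.le (by linarith) hs ht L

theorem mainTheorem4 :
    ∃ ν : ℝ, 0 < ν ∧
      Integrable (fun x : ℝ => RJ.K x * Real.exp (3 * x / 4)) ∧
      -(ν : ℂ) = (RJ.gamma : ℂ) + RJ.hat RJ.K (3 * Complex.I / 4) ∧
      ∀ L : ℝ, ∃ C : ℝ, 0 < C ∧
        ∀ (A B : ℝ), -5 / 2 < B → B < -3 / 4 → 1 / 2 < A → A < 1 →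
        ∀ f₀ : ℝ → ℝ, RJ.MemX A B f₀ →
        ∀ (p : ℝ≥0∞) [Fact (1 ≤ p)], p ≠ ∞ →
          (∃ f : ℝ → Lp ℝ p (volume : Measure ℝ), RJ.IsSolution p f₀ f) ∧
          ∀ f : ℝ → Lp ℝ p (volume : Measure ℝ), RJ.IsSolution p f₀ f →
          ∀ σ : ℝ, 1 / 2 < σ → σ < -B →
          ∀ t : ℝ, 0 < t →
            -- all integrals are absolutely convergent
            Integrable (fun x : ℝ => f t x * Real.exp (x / 2)) ∧
            Integrable (fun x : ℝ => f₀ x * Real.exp (σ * x)) ∧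
            Integrable (fun x : ℝ => RJ.K x * Real.exp (σ * x)) ∧
            Integrable (fun u : ℝ =>
              RJ.contourIntegrand f₀ t L ((u : ℂ) + (σ : ℂ) * Complex.I)) ∧
            Integrable (fun x : ℝ => |f₀ x| * Real.exp (3 * x / 4)) ∧
            -- the total wave action is conserved
            (∫ x : ℝ, f t x * Real.exp (x / 2)) = ∫ x : ℝ, f₀ x * Real.exp (x / 2) ∧
            -- the representation formula
            ((∫ x in Iic L, f t x * Real.exp (x / 2) : ℝ) : ℂ) =
              ((∫ x : ℝ, f t x * Real.exp (x / 2) : ℝ) : ℂ) +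
                1 / (2 * (Real.pi : ℂ)) *
                  ∫ u : ℝ, RJ.contourIntegrand f₀ t L ((u : ℂ) + (σ : ℂ) * Complex.I) ∧
            -- the decay estimate
            ‖∫ u : ℝ, RJ.contourIntegrand f₀ t L ((u : ℂ) + (σ : ℂ) * Complex.I)‖ ≤
              C * Real.exp (-ν * t) * ∫ x : ℝ, |f₀ x| * Real.exp (3 * x / 4) := by
  obtain ⟨ν, hν, hK, hhat, h⟩ :=
    mainTheorem4_general (s := 3 / 4) (by norm_num) (by norm_num)
  simp only [fun x : ℝ => div_mul_eq_mul_div 3 4 x, fun x : ℝ => one_div_mul_eq_div 2 x] at hK h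
  refine ⟨ν, hν, hK, hhat.trans (by push_cast; rw [div_mul_eq_mul_div]), fun L => ?_⟩
  obtain ⟨C, hC, h⟩ := h L
  refine ⟨C, hC, fun A B hB₁ hB₂ hA _ f₀ hX p _ _ => ?_⟩
  obtain ⟨hexists, h⟩ := h A B (by linarith) (by linarith) f₀ hX p
  exact ⟨hexists, fun f hf σ hσ₁ hσB t ht => h f hf σ hσ₁ hσB (by linarith) t ht.le⟩
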